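/- A set $P\subseteq\mathbb{R}^2$ is in \emph{general position} if no three distinct points of $P$ lie on a common line. It is \emph{monotone} if either $u_y\le v_y$ for all $u,v\in P$ with $u_x<v_x$, or $u_y\ge v_y$ for all $u,v\in P$ with $u_x<v_x$. **Theorem.** For a perfect square $n$, let $G_n=\{1,\dots,\sqrt n\}\times\{1,\dots,\sqrt n\}$ be the $\sqrt n\times\sqrt n$ grid of $n$ points, and let $M(n)$ be the largest size of a subset of $G_n$ that is both monotone and in general position. Then, as $n\to\infty$ through the perfect squares, $$M(n)=\Omega\left(\left(\frac{n}{\log n}\right)^{2/5}\right)\qquad\text{and}\qquad M(n)=o(\sqrt n).$$ That is, there are an absolute constant $c>0$ and an $N$ such that $M(n)\ge c\,(n/\log n)^{2/5}$ for every perfect square $n\ge N$; and for every $\varepsilon>0$ there is an $N$ such that $M(n)\le\varepsilon\sqrt n$ for every perfect square $n\ge N$. -/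

import Mathlib

namespace PlanarPoints

/-- A planar point set is in general position if no three distinct points of it lie on a
common line. -/
def InGeneralPosition (P : Set (ℝ × ℝ)) : Prop :=
  ∀ u ∈ P, ∀ v ∈ P, ∀ w ∈ P, u ≠ v → u ≠ w → v ≠ w → ¬ Collinear ℝ ({u, v, w} : Set (ℝ × ℝ))

/-- A planar point set is monotone if, from left to right, the `y`-coordinates never decrease,
or never increase. -/
def IsMonotone (P : Set (ℝ × ℝ)) : Prop :=
  (∀ u ∈ P, ∀ v ∈ P, u.1 < v.1 → u.2 ≤ v.2) ∨
  (∀ u ∈ P, ∀ v ∈ P, u.1 < v.1 → v.2 ≤ u.2)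

/-- The `k × k` integer grid `{1, …, k} × {1, …, k}`, as a set of points of the plane. -/
def grid (k : ℕ) : Set (ℝ × ℝ) :=
  {p | ∃ i ∈ Finset.Icc 1 k, ∃ j ∈ Finset.Icc 1 k, p = ((i : ℝ), (j : ℝ))}

/-- The sizes of the (finite) monotone general position subsets of `G`. -/
def monotoneGPSizes (G : Set (ℝ × ℝ)) : Set ℕ :=
  {m | ∃ P : Finset (ℝ × ℝ), (P : Set (ℝ × ℝ)) ⊆ G ∧ IsMonotone (P : Set (ℝ × ℝ)) ∧
    InGeneralPosition (P : Set (ℝ × ℝ)) ∧ P.card = m}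

/-- The largest size of a monotone general position subset of `G`; it is attained when `G` is
finite, see `isGreatest_maxMonotoneGP`. -/
noncomputable def maxMonotoneGP (G : Set (ℝ × ℝ)) : ℕ := sSup (monotoneGPSizes G)

theorem finite_grid (k : ℕ) : (grid k).Finite := by
  refine (Set.toFinite ((fun p : ℕ × ℕ => ((p.1 : ℝ), (p.2 : ℝ))) ''
    (Finset.Icc 1 k ×ˢ Finset.Icc 1 k : Finset (ℕ × ℕ)))).subset ?_
  rintro p ⟨i, hi, j, hj, rfl⟩
  exact ⟨(i, j), Finset.mem_coe.2 (Finset.mem_product.2 ⟨hi, hj⟩), rfl⟩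

theorem ncard_grid (k : ℕ) : (grid k).ncard = k ^ 2 := by
  have h : grid k = (fun p : ℕ × ℕ => ((p.1 : ℝ), (p.2 : ℝ))) ''
      ((Finset.Icc 1 k ×ˢ Finset.Icc 1 k : Finset (ℕ × ℕ)) : Set (ℕ × ℕ)) := by
    ext p
    constructor
    · rintro ⟨i, hi, j, hj, rfl⟩
      exact ⟨(i, j), Finset.mem_coe.2 (Finset.mem_product.2 ⟨hi, hj⟩), rfl⟩
    · rintro ⟨⟨i, j⟩, hij, rfl⟩
      have hij' := Finset.mem_product.1 (Finset.mem_coe.1 hij)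
      exact ⟨i, hij'.1, j, hij'.2, rfl⟩
  rw [h, Set.ncard_image_of_injective, Set.ncard_coe_finset, Finset.card_product]
  · simp [sq]
  · rintro ⟨a, b⟩ ⟨c, d⟩ hab
    simpa using hab

theorem isGreatest_maxMonotoneGP {G : Set (ℝ × ℝ)} (hG : G.Finite) :
    IsGreatest (monotoneGPSizes G) (maxMonotoneGP G) := by
  have hne : (monotoneGPSizes G).Nonempty :=
    ⟨0, ∅, by simp, by simp [IsMonotone], by simp [InGeneralPosition], rfl⟩
  have hb : BddAbove (monotoneGPSizes G) := by
    refine ⟨G.ncard, ?_⟩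
    rintro m ⟨P, hP, -, -, rfl⟩
    rw [← Set.ncard_coe_finset]
    exact Set.ncard_le_ncard hP hG
  exact ⟨Nat.sSup_mem hne hb, fun m hm => le_csSup hb hm⟩

end PlanarPoints

namespace PlanarPoints

/-! Write `k` for the side of the grid, so `n = k ^ 2`.

Upper bound. After a reflection the set is increasing, and in the coordinate `t = x + y` it is the
graph of a 1-Lipschitz integer function over a set of integers `A` in `[0, 2k]`. If `A` has positive
density, an energy increment over boundedly many scales (`energy_increment`,
`near_line_of_energy_le`) yields a window where `A` is dense and the function is nearly linear.
Approximating the slope by a rational of small denominator puts the points of that window on few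
parallel lines, so three of them share a line (`exists_collinear_of_near_line`). Hence a monotone
set in general position has `o(k)` points.

Lower bound. Place `B` boxes of side `s` along an increasing convex chain; any choice of one point
per box is monotone. A shear moves the chain near the parabola `K y = x ^ 2`, `K = B s`, and there
are only `O(s ^ (5/2) K ^ (3/2) log K)` collinear triples of points in distinct columns
(`NearParabola.card_collinearTriples_le`). A triple from three different boxes survives a uniformly
random choice with probability `s ^ (-6)`, so some choice has at most `B / 2` collinear triples as
soon as `s ^ 5` exceeds a constant times `K (log K) ^ 2`. Deleting one point per triple leaves `B /
2` points. With `K` of order `k`, `s` is of order `(k (log k) ^ 2) ^ (1/5)`, and `B = K / s` is of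
order `(n / log n) ^ (2/5)`. -/

theorem collinear_triple_iff (u v w : ℝ × ℝ) (huv : u ≠ v) :
    Collinear ℝ ({u, v, w} : Set (ℝ × ℝ)) ↔
      (v.1 - u.1) * (w.2 - u.2) = (w.1 - u.1) * (v.2 - u.2) := by
  rw [collinear_iff_of_mem (p₀ := u) (by simp)]
  constructor
  · rintro ⟨d, hd⟩
    obtain ⟨r, hr⟩ := hd v (by simp)
    obtain ⟨q, hq⟩ := hd w (by simp)
    subst hr hq
    simp
    ring
  · intro h
    refine ⟨v - u, ?_⟩
    intro p hp
    simp only [Set.mem_insert_iff, Set.mem_singleton_iff] at hp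
    rcases hp with rfl | rfl | rfl
    · exact ⟨0, by simp⟩
    · exact ⟨1, by simp⟩
    · by_cases h1 : v.1 - u.1 = 0
      · have h2 : v.2 - u.2 ≠ 0 := by
          intro h2
          exact huv (Prod.ext (by linarith) (by linarith))
        refine ⟨(p.2 - u.2) / (v.2 - u.2), Prod.ext ?_ ?_⟩
        · rw [h1, zero_mul] at h
          have h3 : p.1 - u.1 = 0 := by
            rcases mul_eq_zero.1 h.symm with h | h
            · exact h
            · exact absurd h h2
          simp [h1]
          linarith
        · simp
          field_simp
          ring
      · refine ⟨(p.1 - u.1) / (v.1 - u.1), Prod.ext ?_ ?_⟩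
        · simp
          field_simp
          ring
        · simp
          field_simp
          linarith

theorem card_le_of_sub_le (A : Finset ℤ) (R : ℝ) (hR : 0 ≤ R)
    (h : ∀ x ∈ A, ∀ y ∈ A, (x : ℝ) - y ≤ R) : (A.card : ℝ) ≤ R + 1 := by
  rcases A.eq_empty_or_nonempty with rfl | hA
  · simp
    linarith
  · have hsub : A ⊆ Finset.Icc (A.min' hA) (A.min' hA + ⌊R⌋) := by
      intro x hx
      rw [Finset.mem_Icc]
      refine ⟨A.min'_le x hx, ?_⟩
      have : x - A.min' hA ≤ ⌊R⌋ := by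
        rw [Int.le_floor]
        push_cast
        exact h x hx _ (A.min'_mem hA)
      linarith
    have h1 := Finset.card_le_card hsub
    rw [Int.card_Icc] at h1
    have h0 : (0 : ℤ) ≤ ⌊R⌋ := Int.floor_nonneg.2 hR
    have h2 : (A.card : ℤ) ≤ ⌊R⌋ + 1 := by omega
    have h3 : (A.card : ℝ) ≤ (⌊R⌋ : ℝ) + 1 := by exact_mod_cast h2
    linarith [Int.floor_le R]

/-! ### Upper bound: dense Lipschitz graphs contain collinear triples. -/

theorem exists_collinear_of_near_line (A : Finset ℕ) (g : ℕ → ℤ) (a L Q : ℕ) (b s δ : ℝ)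
    (hQ : 0 < Q) (hδ : 0 ≤ δ) (hA : ∀ t ∈ A, a ≤ t ∧ t < a + L)
    (hg : ∀ t ∈ A, |(g t : ℝ) - b - s * ((t : ℝ) - a)| ≤ δ * L)
    (hcard : 2 * (2 * Q * δ * L + L / (Q + 1) + 1) < A.card) :
    ∃ t₁ ∈ A, ∃ t₂ ∈ A, ∃ t₃ ∈ A, t₁ ≠ t₂ ∧ t₁ ≠ t₃ ∧ t₂ ≠ t₃ ∧
      (g t₂ - g t₁) * ((t₃ : ℤ) - t₁) = (g t₃ - g t₁) * ((t₂ : ℤ) - t₁) := by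
  -- Dirichlet: with `p / q` close to the slope, the integer `q * g t - p * t` varies little over
  -- the window. Its level sets lie on parallel lines, so a value taken three times gives the
  -- triple.
  obtain ⟨p, q, hq0, hqQ, hpq⟩ := Real.exists_int_int_abs_mul_sub_le s hQ
  set v : ℕ → ℤ := fun t => q * g t - p * t with hv
  have hq0' : (0 : ℝ) < q := by exact_mod_cast hq0
  have hqQ' : (q : ℝ) ≤ Q := by exact_mod_cast hqQ
  have himg : ((A.image v).card : ℝ) ≤ (2 * Q * δ * L + L / (Q + 1)) + 1 := by
    apply card_le_of_sub_le
    · positivity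
    · intro x hx y hy
      obtain ⟨t, ht, rfl⟩ := Finset.mem_image.1 hx
      obtain ⟨t', ht', rfl⟩ := Finset.mem_image.1 hy
      have e : ((v t : ℤ) : ℝ) - (v t' : ℤ) =
          q * (((g t : ℝ) - b - s * ((t : ℝ) - a)) - ((g t' : ℝ) - b - s * ((t' : ℝ) - a)))
          + (q * s - p) * ((t : ℝ) - t') := by
        simp only [hv]
        push_cast
        ring
      rw [e]
      have h1 := abs_le.1 (hg t ht)
      have h2 := abs_le.1 (hg t' ht')
      have hL : (0 : ℝ) ≤ δ * L := by positivity
      have h3 : (q : ℝ) * (((g t : ℝ) - b - s * ((t : ℝ) - a))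
          - ((g t' : ℝ) - b - s * ((t' : ℝ) - a))) ≤ Q * (2 * (δ * L)) := by
        calc _ ≤ (q : ℝ) * (2 * (δ * L)) := by
              apply mul_le_mul_of_nonneg_left _ hq0'.le
              linarith
          _ ≤ _ := by
              apply mul_le_mul_of_nonneg_right hqQ'
              positivity
      have h4 : |(t : ℝ) - t'| ≤ L := by
        have a1 : (a : ℝ) ≤ t := by exact_mod_cast (hA t ht).1
        have a2 : (t : ℝ) < a + L := by exact_mod_cast (hA t ht).2
        have a3 : (a : ℝ) ≤ t' := by exact_mod_cast (hA t' ht').1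
        have a4 : (t' : ℝ) < a + L := by exact_mod_cast (hA t' ht').2
        rw [abs_le]
        constructor <;> linarith
      have h5 : (q * s - p) * ((t : ℝ) - t') ≤ 1 / (Q + 1) * L := by
        calc _ ≤ |(q * s - p) * ((t : ℝ) - t')| := le_abs_self _
          _ = |q * s - p| * |(t : ℝ) - t'| := abs_mul _ _
          _ ≤ _ := by
              apply mul_le_mul hpq h4 (abs_nonneg _)
              positivity
      have h6 : (1 : ℝ) / (Q + 1) * L = L / (Q + 1) := by ring
      linarith
  have hlt : (A.image v).card * 2 < A.card := by
    have : ((A.image v).card : ℝ) * 2 < A.card := by linarith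
    exact_mod_cast this
  obtain ⟨y, -, hy⟩ := Finset.exists_lt_card_fiber_of_mul_lt_card_of_maps_to
    (fun t ht => Finset.mem_image_of_mem v ht) hlt
  obtain ⟨t₁, t₂, t₃, h1, h2, h3, h12, h13, h23⟩ := Finset.two_lt_card_iff.1 hy
  rw [Finset.mem_filter] at h1 h2 h3
  refine ⟨t₁, h1.1, t₂, h2.1, t₃, h3.1, h12, h13, h23, ?_⟩
  have e2 : (q : ℤ) * (g t₂ - g t₁) = p * (t₂ - t₁) := by
    have := h2.2.trans h1.2.symm
    simp only [hv] at this
    linarith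
  have e3 : (q : ℤ) * (g t₃ - g t₁) = p * (t₃ - t₁) := by
    have := h3.2.trans h1.2.symm
    simp only [hv] at this
    linarith
  apply mul_left_cancel₀ hq0.ne'
  linear_combination ((t₃ : ℤ) - t₁) * e2 - ((t₂ : ℤ) - t₁) * e3

theorem card_inter_Ico_mul (A : Finset ℕ) (a L m : ℕ) :
    (A ∩ Finset.Ico a (a + m * L)).card =
      ∑ r ∈ Finset.range m, (A ∩ Finset.Ico (a + r * L) (a + r * L + L)).card := by
  induction m with
  | zero => simp
  | succ m ih =>
    rw [Finset.sum_range_succ, ← ih, ← Finset.card_union_of_disjoint]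
    · congr 1
      rw [← Finset.inter_union_distrib_left, Finset.Ico_union_Ico_eq_Ico (by simp) (by simp)]
      congr 2
      ring
    · rw [Finset.disjoint_left]
      intro x hx hx'
      simp only [Finset.mem_inter, Finset.mem_Ico] at hx hx'
      omega

theorem card_inter_Ico_le (A : Finset ℕ) (a L : ℕ) :
    ((A ∩ Finset.Ico a (a + L)).card : ℝ) ≤ L := by
  have := Finset.card_le_card (Finset.inter_subset_right (s₁ := A) (s₂ := Finset.Ico a (a + L)))
  rw [Nat.card_Ico, Nat.add_sub_cancel_left] at this
  exact_mod_cast this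

/-- An energy increment argument: if no window at any scale is at the same time dense and close
to linear, then the top window is sparse. -/
theorem energy_increment (A : Finset ℕ) (h : ℕ → ℝ) (m l : ℕ) (η θ : ℝ)
    (hl : 0 < l) (hm : 0 < m) (hη : 0 ≤ η) (hθ : 0 ≤ θ)
    (hh : ∀ i j : ℕ, |h i - h j| ≤ |(i : ℝ) - j|)
    (H : ∀ a j : ℕ, ((A ∩ Finset.Ico a (a + m * (l * m ^ j))).card : ℝ) ≤ θ * (m * (l * m ^ j)) ∨
      (h (a + m * (l * m ^ j)) - h a) ^ 2 / (m * (l * m ^ j)) + η * (m * (l * m ^ j)) ≤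
        ∑ r ∈ Finset.range m,
          (h (a + r * (l * m ^ j) + l * m ^ j) - h (a + r * (l * m ^ j))) ^ 2 / (l * m ^ j))
    (J : ℕ) : ∀ a : ℕ, J * η * ((A ∩ Finset.Ico a (a + l * m ^ J)).card - θ * (l * m ^ J)) ≤
      l * m ^ J - (h (a + l * m ^ J) - h a) ^ 2 / (l * m ^ J) := by
  have hE : ∀ a L : ℕ, 0 < L → (h (a + L) - h a) ^ 2 / (L : ℝ) ≤ L := by
    intro a L hL
    have hL' : (0 : ℝ) < L := by exact_mod_cast hL
    have h1 := hh (a + L) a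
    push_cast at h1
    rw [add_sub_cancel_left, abs_of_pos hL'] at h1
    rw [div_le_iff₀ hL', ← sq, ← sq_abs]
    exact pow_le_pow_left₀ (abs_nonneg _) h1 2
  induction J with
  | zero =>
    intro a
    have := hE a (l * m ^ 0) (by simpa using hl)
    push_cast at this ⊢
    simp only [zero_mul]
    linarith
  | succ J ih =>
    intro a
    have e : l * m ^ (J + 1) = m * (l * m ^ J) := by ring
    have e' : (l : ℝ) * m ^ (J + 1) = m * (l * m ^ J) := by ring
    rw [e, e']
    set L := l * m ^ J with hLdef
    have eL : (l : ℝ) * m ^ J = (L : ℝ) := by rw [hLdef]; push_cast; ring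
    have hL : 0 < L := by positivity
    have HH := H a J
    rw [← hLdef, eL] at HH
    rw [eL]
    rw [eL] at ih
    set C : ℝ := ((A ∩ Finset.Ico a (a + m * L)).card : ℝ) with hC
    have hEtop := hE a (m * L) (by positivity)
    push_cast at hEtop
    -- In a sparse window the left side is nonpositive, and the right side is nonnegative by the
    -- Lipschitz bound. Otherwise the induction hypotheses on the `m` pieces are added, and the
    -- energy gain `η * (m * L)` pays for one more multiple of `η * (C - θ * (m * L))`.
    rcases HH with h1 | h1
    · have : ((J + 1 : ℕ) : ℝ) * η * (C - θ * (m * L)) ≤ 0 := by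
        apply mul_nonpos_of_nonneg_of_nonpos
        · positivity
        · linarith
      linarith
    · have hsum := Finset.sum_le_sum (fun r (_ : r ∈ Finset.range m) => ih (a + r * L))
      rw [← Finset.mul_sum, Finset.sum_sub_distrib, Finset.sum_sub_distrib] at hsum
      simp only [Finset.sum_const, Finset.card_range, nsmul_eq_mul] at hsum
      have hC' : C = ∑ r ∈ Finset.range m,
          ((A ∩ Finset.Ico (a + r * L) (a + r * L + L)).card : ℝ) := by
        rw [hC, card_inter_Ico_mul]
        push_cast
        rfl
      rw [← hC'] at hsum
      have hCle : C ≤ m * L := by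
        have := card_inter_Ico_le A a (m * L)
        push_cast at this
        exact this
      have h2 : η * (C - θ * (m * L)) ≤ η * (m * L) := by
        apply mul_le_mul_of_nonneg_left _ hη
        have : 0 ≤ θ * ((m : ℝ) * L) := by positivity
        linarith
      push_cast
      have e3 : (m : ℝ) * (θ * L) = θ * (m * L) := by ring
      rw [e3] at hsum
      linarith

/-- If subdividing a window does not increase the energy by much, then the function is close to
linear on that window. -/
theorem near_line_of_energy_le (h : ℕ → ℝ) (a L m : ℕ) (η : ℝ) (hL : 0 < L) (hm : 0 < m)
    (hη : 0 ≤ η) (hh : ∀ i j : ℕ, |h i - h j| ≤ |(i : ℝ) - j|)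
    (H : ∑ r ∈ Finset.range m, (h (a + r * L + L) - h (a + r * L)) ^ 2 / (L : ℝ) ≤
      (h (a + m * L) - h a) ^ 2 / (m * L) + η * (m * L)) (t : ℕ) (ht : a ≤ t)
    (ht' : t < a + m * L) :
    |h t - h a - (h (a + m * L) - h a) / (m * L) * ((t : ℝ) - a)| ≤
      2 * L + Real.sqrt η * (m * L) := by
  set D := h (a + m * L) - h a with hD
  have hL' : (0 : ℝ) < L := by exact_mod_cast hL
  have hm' : (0 : ℝ) < m := by exact_mod_cast hm
  set d : ℕ → ℝ := fun r => h (a + r * L + L) - h (a + r * L) with hd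
  have htel : ∀ r, ∑ i ∈ Finset.range r, d i = h (a + r * L) - h a := by
    intro r
    have := Finset.sum_range_sub (fun r => h (a + r * L)) r
    simp only [zero_mul, add_zero] at this
    rw [← this]
    apply Finset.sum_congr rfl
    intro i _
    simp only [hd]
    congr 2
    ring
  -- The energy gain is the variance of the block increments, up to normalisation. Cauchy-Schwarz
  -- then controls their partial sums, that is, the deviation from the chord at block endpoints;
  -- inside a block both the function and the chord move by at most `L`.
  have hvar : ∑ r ∈ Finset.range m, (d r - D / m) ^ 2 ≤ η * m * L ^ 2 := by
    have e1 : ∑ r ∈ Finset.range m, (d r - D / m) ^ 2 =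
        ∑ r ∈ Finset.range m, d r ^ 2 - D ^ 2 / m := by
      have : ∀ r, (d r - D / m) ^ 2 = d r ^ 2 - 2 * D / m * d r + D ^ 2 / m ^ 2 := by
        intro r
        field_simp
        ring
      simp only [this]
      rw [Finset.sum_add_distrib, Finset.sum_sub_distrib, ← Finset.mul_sum, htel m]
      simp only [Finset.sum_const, Finset.card_range, nsmul_eq_mul]
      rw [← hD]
      field_simp
      ring
    rw [e1]
    rw [← Finset.sum_div, div_le_iff₀ hL'] at H
    have : (D ^ 2 / (m * L) + η * (m * L)) * L = D ^ 2 / m + η * m * L ^ 2 := by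
      field_simp
    rw [this] at H
    linarith
  set r := (t - a) / L with hr
  have hrm : r < m := by
    rw [hr, Nat.div_lt_iff_lt_mul hL]
    omega
  have hr1 : r * L ≤ t - a := Nat.div_mul_le_self _ _
  have hr2 : t - a < r * L + L := by
    have := Nat.lt_div_mul_add (a := t - a) hL
    exact this
  have hr1' : (a : ℝ) + r * L ≤ t := by
    have : a + r * L ≤ t := by omega
    exact_mod_cast this
  have hr2' : (t : ℝ) < a + r * L + L := by
    have : t < a + r * L + L := by omega
    exact_mod_cast this
  have hpart : |h (a + r * L) - h a - D / m * r| ≤ Real.sqrt η * (m * L) := by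
    have e2 : h (a + r * L) - h a - D / m * r = ∑ i ∈ Finset.range r, (d i - D / m) := by
      rw [Finset.sum_sub_distrib, htel r]
      simp
      ring
    rw [e2]
    apply abs_le_of_sq_le_sq _ (by positivity)
    rw [mul_pow, Real.sq_sqrt hη]
    calc (∑ i ∈ Finset.range r, (d i - D / m)) ^ 2
        ≤ (Finset.range r).card * ∑ i ∈ Finset.range r, (d i - D / m) ^ 2 :=
          sq_sum_le_card_mul_sum_sq
      _ ≤ m * ∑ i ∈ Finset.range m, (d i - D / m) ^ 2 := by
          apply mul_le_mul
          · rw [Finset.card_range]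
            exact_mod_cast hrm.le
          · apply Finset.sum_le_sum_of_subset_of_nonneg
            · intro x hx
              simp only [Finset.mem_range] at hx ⊢
              omega
            · intros
              positivity
          · positivity
          · positivity
      _ ≤ m * (η * m * L ^ 2) := by gcongr
      _ = η * (m * L) ^ 2 := by ring
  have hDle : |D / (m * L)| ≤ 1 := by
    rw [abs_div, abs_of_pos (by positivity : (0 : ℝ) < m * L), div_le_one (by positivity)]
    have := hh (a + m * L) a
    push_cast at this
    rwa [add_sub_cancel_left, abs_of_pos (by positivity : (0 : ℝ) < m * L)] at this
  have h1 : |h t - h (a + r * L)| ≤ L := by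
    refine (hh _ _).trans ?_
    push_cast
    rw [abs_le]
    constructor <;> linarith
  have h2 : |D / (m * L) * ((t : ℝ) - a - r * L)| ≤ L := by
    rw [abs_mul]
    calc _ ≤ 1 * |(t : ℝ) - a - r * L| := by gcongr
      _ ≤ L := by
        rw [one_mul, abs_le]
        constructor <;> linarith
  have e4 : h t - h a - D / (m * L) * ((t : ℝ) - a) =
      (h t - h (a + r * L)) + (h (a + r * L) - h a - D / m * r) -
        D / (m * L) * ((t : ℝ) - a - r * L) := by
    field_simp
    ring
  rw [e4]
  have h1' := abs_le.1 h1
  have h2' := abs_le.1 h2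
  have h3' := abs_le.1 hpart
  rw [abs_le]
  constructor <;> linarith

/-- Energy is at most the window length, so it cannot grow by a fixed proportion at each of `J`
scales while `A` stays dense. Some window is therefore dense and nearly linear, and pigeonhole
applies there. -/
theorem exists_collinear_of_dense_lipschitz (ε : ℝ) (hε : 0 < ε) : ∃ N₀ : ℕ, ∀ N : ℕ, N₀ ≤ N →
    ∀ (A : Finset ℕ) (g : ℕ → ℤ), (∀ t ∈ A, t < N) →
      (∀ t ∈ A, ∀ t' ∈ A, |(g t : ℝ) - g t'| ≤ |(t : ℝ) - t'|) → ε * N ≤ A.card →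
      ∃ t₁ ∈ A, ∃ t₂ ∈ A, ∃ t₃ ∈ A, t₁ ≠ t₂ ∧ t₁ ≠ t₃ ∧ t₂ ≠ t₃ ∧
        (g t₂ - g t₁) * ((t₃ : ℤ) - t₁) = (g t₃ - g t₁) * ((t₂ : ℤ) - t₁) := by
  -- The parameters make each of the three terms in the pigeonhole threshold at most `θ / 3` of the
  -- window, while `m` and `η` each contribute half of the allowed deviation `δ` from a line.
  set θ : ℝ := ε / 4 with hθdef
  have hθ : 0 < θ := by positivity
  set Q : ℕ := ⌈6 / θ⌉₊ with hQdef
  have hQ : 0 < Q := Nat.ceil_pos.2 (by positivity)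
  have hQ' : (0 : ℝ) < Q := by exact_mod_cast hQ
  have hQ6 : 6 / θ ≤ Q := Nat.le_ceil _
  set δ : ℝ := θ / (12 * Q) with hδdef
  have hδ : 0 < δ := by positivity
  set m : ℕ := ⌈4 / δ⌉₊ with hmdef
  have hm : 0 < m := Nat.ceil_pos.2 (by positivity)
  have hm' : (0 : ℝ) < m := by exact_mod_cast hm
  have hm4 : 4 / δ ≤ m := Nat.le_ceil _
  set η : ℝ := (δ / 2) ^ 2 with hηdef
  have hη : 0 < η := by positivity
  obtain ⟨J, hJ⟩ := exists_nat_gt (1 / (η * θ))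
  have hJ' : 1 < J * η * θ := by
    rw [div_lt_iff₀ (by positivity)] at hJ
    linarith
  refine ⟨m ^ J * (⌈6 / θ⌉₊ + 1), ?_⟩
  intro N hN A g hA hg hcard
  have hmJ : 0 < m ^ J := by positivity
  -- The top window `l * m ^ J` covers `[0, N)` but has length at most `2 * N`, so `A` has density
  -- at least `2 * θ` in it.
  set l : ℕ := N / m ^ J + 1 with hl
  have hl6 : 6 / θ ≤ l := by
    have : ⌈6 / θ⌉₊ + 1 ≤ N / m ^ J := by
      rw [Nat.le_div_iff_mul_le hmJ]
      linarith
    have h2 : (⌈6 / θ⌉₊ : ℝ) ≤ l := by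
      have : ⌈6 / θ⌉₊ ≤ l := by omega
      exact_mod_cast this
    exact (Nat.le_ceil _).trans h2
  have hNL : N < l * m ^ J := by
    have := Nat.lt_div_mul_add (a := N) hmJ
    rw [hl]
    linarith
  have hLN : l * m ^ J ≤ 2 * N := by
    have h1 := Nat.div_mul_le_self N (m ^ J)
    have h2 : m ^ J ≤ N := le_trans (Nat.le_mul_of_pos_right _ (by omega)) hN
    rw [hl]
    linarith
  have hlpos : 0 < l := Nat.succ_pos _
  -- Energies need values at window endpoints, which may lie outside `A`.
  obtain ⟨h, hh, hgh⟩ := LipschitzOnWith.extend_real (f := fun t : ℕ => (g t : ℝ))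
    (s := (A : Set ℕ)) (K := 1) (by
      apply LipschitzOnWith.of_dist_le_mul
      intro x hx y hy
      rw [Real.dist_eq, Nat.dist_eq]
      simpa using hg x hx y hy)
  have hh' : ∀ i j : ℕ, |h i - h j| ≤ |(i : ℝ) - j| := by
    intro i j
    have := hh.dist_le_mul i j
    rw [Real.dist_eq, Nat.dist_eq] at this
    simpa using this
  by_contra hcon
  have key := energy_increment A h m l η θ hlpos hm hη.le hθ.le hh' ?_ J 0
  · rw [zero_add] at key
    have hAI : A ∩ Finset.Ico 0 (l * m ^ J) = A := by
      apply Finset.inter_eq_left.2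
      intro t ht
      exact Finset.mem_Ico.2 ⟨Nat.zero_le _, (hA t ht).trans hNL⟩
    rw [hAI] at key
    have hLpos : (0 : ℝ) < l * m ^ J := by positivity
    have hLN' : (l : ℝ) * m ^ J ≤ 2 * N := by exact_mod_cast hLN
    have h1 : θ * (l * m ^ J) ≤ A.card - θ * (l * m ^ J) := by
      have : ε * (l * m ^ J) ≤ ε * (2 * N) := by gcongr
      have e : ε = 4 * θ := by rw [hθdef]; ring
      rw [e] at this hcard
      linarith
    have h2 : J * η * (θ * (l * m ^ J)) ≤ J * η * (A.card - θ * (l * m ^ J)) := by gcongr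
    have h3 : (0 : ℝ) ≤ (h (l * m ^ J) - h 0) ^ 2 / (l * m ^ J) := by positivity
    have h4 : 1 * (l * m ^ J) < J * η * θ * (l * m ^ J) := by gcongr
    linarith
  · intro a j
    by_contra hno
    push Not at hno
    obtain ⟨hd, hE⟩ := hno
    set L := l * m ^ j with hL
    have eL : (l : ℝ) * m ^ j = (L : ℝ) := by rw [hL]; push_cast; ring
    rw [eL] at hd hE
    have hLpos : 0 < L := by positivity
    have hLpos' : (0 : ℝ) < L := by exact_mod_cast hLpos
    have hlin := near_line_of_energy_le h a L m η hLpos hm hη.le hh' hE.le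
    have key := exists_collinear_of_near_line (A ∩ Finset.Ico a (a + m * L)) g a (m * L) Q (h a)
      ((h (a + m * L) - h a) / (m * L)) δ hQ hδ.le ?_ ?_ ?_
    · obtain ⟨t₁, h1, t₂, h2, t₃, h3, h123⟩ := key
      exact hcon ⟨t₁, (Finset.mem_inter.1 h1).1, t₂, (Finset.mem_inter.1 h2).1, t₃,
        (Finset.mem_inter.1 h3).1, h123⟩
    · intro t ht
      simpa using (Finset.mem_inter.1 ht).2
    · intro t ht
      have ht2 := Finset.mem_Ico.1 (Finset.mem_inter.1 ht).2
      have e : (g t : ℝ) = h t := hgh (Finset.mem_inter.1 ht).1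
      rw [e]
      refine (hlin t ht2.1 ht2.2).trans ?_
      rw [hηdef, Real.sqrt_sq (by positivity)]
      push_cast
      have : 4 ≤ δ * m := by
        rw [div_le_iff₀ hδ] at hm4
        linarith
      have : 4 * (L : ℝ) ≤ δ * m * L := by gcongr
      linarith
    · refine lt_of_le_of_lt ?_ hd
      push_cast
      have hML : (0 : ℝ) < m * L := by positivity
      have b1 : 2 * (2 * (Q : ℝ) * δ * (m * L)) = θ / 3 * (m * L) := by
        rw [hδdef]
        field_simp
        norm_num
      have b2 : (m : ℝ) * L / (Q + 1) ≤ θ / 6 * (m * L) := by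
        rw [div_le_iff₀ (by positivity)]
        have : 6 ≤ θ * Q := by
          rw [div_le_iff₀ hθ] at hQ6
          linarith
        have h6 : 1 ≤ θ / 6 * (Q + 1) := by linarith
        have : 1 * (m * L : ℝ) ≤ θ / 6 * (Q + 1) * (m * L) := by gcongr
        linarith
      have b3 : 2 ≤ θ / 3 * (m * L) := by
        have a1 : 6 ≤ θ * l := by
          rw [div_le_iff₀ hθ] at hl6
          linarith
        have a2 : (l : ℝ) ≤ m * L := by
          have : l ≤ m * L := by
            rw [hL]
            exact le_trans (Nat.le_mul_of_pos_right _ (by positivity))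
              (Nat.le_mul_of_pos_left _ hm)
          exact_mod_cast this
        have : θ * l ≤ θ * (m * L) := by gcongr
        linarith
      linarith

/-- An increasing set may have vertical steps, so it need not be a graph over `x`; but `x + y` is
injective on it, and `x` is a 1-Lipschitz function of `x + y`. This linear change of coordinates
preserves collinearity. -/
theorem exists_collinear_of_increasing (ε : ℝ) (hε : 0 < ε) : ∃ N₀ : ℕ, ∀ k : ℕ, N₀ ≤ k →
    ∀ P : Finset (ℕ × ℕ), (∀ p ∈ P, p.1 ≤ k ∧ p.2 ≤ k) →
      (∀ u ∈ P, ∀ v ∈ P, u.1 < v.1 → u.2 ≤ v.2) → ε * k < P.card →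
      ∃ u ∈ P, ∃ v ∈ P, ∃ w ∈ P, u ≠ v ∧ u ≠ w ∧ v ≠ w ∧
        ((v.1 : ℤ) - u.1) * ((w.2 : ℤ) - u.2) = ((w.1 : ℤ) - u.1) * ((v.2 : ℤ) - u.2) := by
  classical
  obtain ⟨N₀, hN₀⟩ := exists_collinear_of_dense_lipschitz (ε / 3) (by positivity)
  refine ⟨N₀ + 1, fun k hk P hP hmono hcard => ?_⟩
  have hlt : ∀ u ∈ P, ∀ v ∈ P, u.1 + u.2 ≤ v.1 + v.2 → u.1 ≤ v.1 ∧ u.2 ≤ v.2 := by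
    intro u hu v hv huv
    rcases lt_trichotomy u.1 v.1 with h | h | h
    · exact ⟨h.le, hmono u hu v hv h⟩
    · omega
    · have := hmono v hv u hu h
      omega
  have hinj : ∀ u ∈ P, ∀ v ∈ P, u.1 + u.2 = v.1 + v.2 → u = v := by
    intro u hu v hv huv
    have h1 := hlt u hu v hv huv.le
    have h2 := hlt v hv u hu huv.ge
    exact Prod.ext (by omega) (by omega)
  set A := P.image (fun p => p.1 + p.2) with hA
  have hAcard : A.card = P.card := Finset.card_image_of_injOn (fun u hu v hv h => hinj u hu v hv h)
  have hex : ∀ t : ℕ, ∃ p : ℕ × ℕ, t ∈ A → p ∈ P ∧ p.1 + p.2 = t := by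
    intro t
    by_cases ht : t ∈ A
    · obtain ⟨p, hp, hpt⟩ := Finset.mem_image.1 ht
      exact ⟨p, fun _ => ⟨hp, hpt⟩⟩
    · exact ⟨0, fun h => absurd h ht⟩
  choose φ hφ using hex
  have key := hN₀ (2 * k + 1) (by omega) A (fun t => ((φ t).1 : ℤ)) ?_ ?_ ?_
  · obtain ⟨t₁, h1, t₂, h2, t₃, h3, h12, h13, h23, e⟩ := key
    obtain ⟨m1, s1⟩ := hφ t₁ h1
    obtain ⟨m2, s2⟩ := hφ t₂ h2
    obtain ⟨m3, s3⟩ := hφ t₃ h3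
    refine ⟨φ t₁, m1, φ t₂, m2, φ t₃, m3, ?_, ?_, ?_, ?_⟩
    · intro h
      rw [h] at s1
      omega
    · intro h
      rw [h] at s1
      omega
    · intro h
      rw [h] at s2
      omega
    · have s1' : (t₁ : ℤ) = (φ t₁).1 + (φ t₁).2 := by exact_mod_cast s1.symm
      have s2' : (t₂ : ℤ) = (φ t₂).1 + (φ t₂).2 := by exact_mod_cast s2.symm
      have s3' : (t₃ : ℤ) = (φ t₃).1 + (φ t₃).2 := by exact_mod_cast s3.symm
      generalize ((φ t₁).1 : ℤ) = x1 at *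
      generalize ((φ t₂).1 : ℤ) = x2 at *
      generalize ((φ t₃).1 : ℤ) = x3 at *
      rw [s1', s2', s3'] at e
      linarith
  · intro t ht
    obtain ⟨m1, s1⟩ := hφ t ht
    have := hP _ m1
    omega
  · have hone : ∀ t ∈ A, ∀ t' ∈ A, t ≤ t' →
        |(((φ t).1 : ℤ) : ℝ) - ((φ t').1 : ℤ)| ≤ |(t : ℝ) - t'| := by
      intro t ht t' ht' htt
      obtain ⟨m1, s1⟩ := hφ t ht
      obtain ⟨m2, s2⟩ := hφ t' ht'
      obtain ⟨c1, c2⟩ := hlt _ m1 _ m2 (by omega)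
      have h1 : (((φ t).1 : ℕ) : ℝ) ≤ (φ t').1 := by exact_mod_cast c1
      have h2 : (((φ t).2 : ℕ) : ℝ) ≤ (φ t').2 := by exact_mod_cast c2
      have s1' : (((φ t).1 : ℕ) : ℝ) + (φ t).2 = t := by exact_mod_cast s1
      have s2' : (((φ t').1 : ℕ) : ℝ) + (φ t').2 = t' := by exact_mod_cast s2
      rw [Int.cast_natCast, Int.cast_natCast, abs_of_nonpos (by linarith),
        abs_of_nonpos (by linarith)]
      linarith
    intro t ht t' ht'
    rcases le_total t t' with h | h
    · exact hone t ht t' ht' h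
    · rw [abs_sub_comm, abs_sub_comm (t : ℝ)]
      exact hone t' ht' t ht h
  · rw [hAcard]
    refine le_trans ?_ hcard.le
    have : (1 : ℝ) ≤ k := by exact_mod_cast (by omega : 1 ≤ k)
    push_cast
    have : ε * 1 ≤ ε * k := by gcongr
    linarith

theorem maxMonotoneGP_grid_le (ε : ℝ) (hε : 0 < ε) : ∃ N₀ : ℕ, ∀ k : ℕ, N₀ ≤ k →
    (maxMonotoneGP (grid k) : ℝ) ≤ ε * k := by
  classical
  obtain ⟨N₀, hN₀⟩ := exists_collinear_of_increasing ε hε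
  refine ⟨N₀, fun k hk => ?_⟩
  obtain ⟨P, hPG, hmono, hgp, hcard⟩ := (isGreatest_maxMonotoneGP (finite_grid k)).1
  by_contra hlt
  push Not at hlt
  set c : ℕ × ℕ → ℝ × ℝ := fun p => ((p.1 : ℝ), (p.2 : ℝ)) with hc
  have hcinj : Function.Injective c := by
    rintro ⟨a, b⟩ ⟨a', b'⟩ h
    simpa [hc] using h
  set R : Finset (ℕ × ℕ) := (Finset.Icc 1 k ×ˢ Finset.Icc 1 k).filter (fun p => c p ∈ P) with hR
  have hRP : R.image c = P := by
    ext p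
    simp only [Finset.mem_image, hR, Finset.mem_filter, Finset.mem_product]
    constructor
    · rintro ⟨q, ⟨-, hq⟩, rfl⟩
      exact hq
    · intro hp
      obtain ⟨i, hi, j, hj, rfl⟩ := hPG hp
      exact ⟨(i, j), ⟨⟨hi, hj⟩, hp⟩, rfl⟩
  have hRcard : R.card = P.card := by
    rw [← hRP, Finset.card_image_of_injective _ hcinj]
  have hmem : ∀ p ∈ R, (1 ≤ p.1 ∧ p.1 ≤ k) ∧ (1 ≤ p.2 ∧ p.2 ≤ k) ∧ c p ∈ P := by
    intro p hp
    simp only [hR, Finset.mem_filter, Finset.mem_product, Finset.mem_Icc] at hp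
    tauto
  have hfin : ∀ u ∈ R, ∀ v ∈ R, ∀ w ∈ R, u ≠ v → u ≠ w → v ≠ w →
      ((v.1 : ℤ) - u.1) * ((w.2 : ℤ) - u.2) ≠ ((w.1 : ℤ) - u.1) * ((v.2 : ℤ) - u.2) := by
    intro u hu v hv w hw h1 h2 h3 e
    apply hgp _ (hmem u hu).2.2 _ (hmem v hv).2.2 _ (hmem w hw).2.2 (hcinj.ne h1) (hcinj.ne h2)
      (hcinj.ne h3)
    rw [collinear_triple_iff _ _ _ (hcinj.ne h1)]
    simp only [hc]
    exact_mod_cast e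
  rcases hmono with hm | hm
  · obtain ⟨u, hu, v, hv, w, hw, h1, h2, h3, e⟩ := hN₀ k hk R
      (fun p hp => ⟨(hmem p hp).1.2, (hmem p hp).2.1.2⟩)
      (fun u hu v hv huv => by
        have := hm _ (hmem u hu).2.2 _ (hmem v hv).2.2 (by simpa [hc] using huv)
        simpa [hc] using this) (by rw [hRcard, hcard]; exact hlt)
    exact hfin u hu v hv w hw h1 h2 h3 e
  -- A decreasing set is reflected into an increasing one; the subtraction never truncates, since
  -- heights are at most `k`.
  · set f : ℕ × ℕ → ℕ × ℕ := fun p => (p.1, k - p.2) with hf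
    have hfinj : Set.InjOn f R := by
      intro u hu v hv h
      have a := (hmem u hu).2.1
      have b := (hmem v hv).2.1
      simp only [hf, Prod.mk.injEq] at h
      exact Prod.ext h.1 (by omega)
    obtain ⟨u', hu', v', hv', w', hw', h1, h2, h3, e⟩ := hN₀ k hk (R.image f)
      (fun p hp => by
        obtain ⟨q, hq, rfl⟩ := Finset.mem_image.1 hp
        have := hmem q hq
        simp only [hf]
        omega)
      (fun u' hu' v' hv' huv => by
        obtain ⟨u, hu, rfl⟩ := Finset.mem_image.1 hu'
        obtain ⟨v, hv, rfl⟩ := Finset.mem_image.1 hv'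
        have := hm _ (hmem u hu).2.2 _ (hmem v hv).2.2 (by simpa [hc, hf] using huv)
        simp only [hc, Nat.cast_le] at this
        simp only [hf]
        omega)
      (by rw [Finset.card_image_of_injOn hfinj, hRcard, hcard]; exact hlt)
    obtain ⟨u, hu, rfl⟩ := Finset.mem_image.1 hu'
    obtain ⟨v, hv, rfl⟩ := Finset.mem_image.1 hv'
    obtain ⟨w, hw, rfl⟩ := Finset.mem_image.1 hw'
    apply hfin u hu v hv w hw (fun h => h1 (by rw [h])) (fun h => h2 (by rw [h]))
      (fun h => h3 (by rw [h]))
    have a := (hmem u hu).2.1.2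
    have b := (hmem v hv).2.1.2
    have d := (hmem w hw).2.1.2
    simp only [hf] at e
    push_cast [Nat.cast_sub a, Nat.cast_sub b, Nat.cast_sub d] at e
    linarith

/-! ### Lower bound: averaging over random choices. -/

open Finset in
theorem card_filter_three_values_mul {ι O : Type*} [Fintype ι] [DecidableEq ι] [Fintype O]
    [DecidableEq O] (i j l : ι) (hij : i ≠ j) (hil : i ≠ l) (hjl : j ≠ l) (a b c : O) :
    #{ω : ι → O | ω i = a ∧ ω j = b ∧ ω l = c} * Fintype.card O ^ 3 =
      Fintype.card O ^ Fintype.card ι := by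
  set F : ι → Finset O := fun x => if x = i then {a} else if x = j then {b} else
    if x = l then {c} else univ with hF
  have e : ({ω : ι → O | ω i = a ∧ ω j = b ∧ ω l = c} : Finset (ι → O)) = Fintype.piFinset F := by
    ext ω
    simp only [mem_filter, mem_univ, true_and, Fintype.mem_piFinset]
    constructor
    · rintro ⟨h1, h2, h3⟩ x
      simp only [hF]
      split_ifs with c1 c2 c3
      · simp [c1, h1]
      · simp [c2, h2]
      · simp [c3, h3]
      · simp
    · intro h
      have h1 := h i
      have h2 := h j
      have h3 := h l
      simp only [hF, if_true, hij.symm, hil.symm, hjl.symm, if_false, mem_singleton] at h1 h2 h3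
      exact ⟨h1, h2, h3⟩
  have hcard : #({i, j, l} : Finset ι) = 3 := by
    rw [card_eq_three]
    exact ⟨i, j, l, hij, hil, hjl, rfl⟩
  have e2 : Fintype.card O ^ 3 = ∏ x : ι, if x ∈ ({i, j, l} : Finset ι) then Fintype.card O
      else 1 := by
    rw [prod_ite_mem, univ_inter, prod_const, hcard]
  rw [e, Fintype.card_piFinset, e2, ← prod_mul_distrib, ← card_univ (α := ι), ← prod_const]
  apply prod_congr rfl
  intro x _
  simp only [hF, mem_insert, mem_singleton]
  by_cases c1 : x = i
  · simp [c1]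
  · by_cases c2 : x = j
    · simp [c2, hij.symm]
    · by_cases c3 : x = l
      · simp [c3, hil.symm, hjl.symm]
      · simp [c1, c2, c3]

open Finset in
/-- If each of the variables indexed by `Fin B` takes values in `O`, then some assignment of values
satisfies at most an average number of ternary constraints. -/
theorem exists_assignment_card_le {O : Type*} [Fintype O] [DecidableEq O] [Nonempty O] (B : ℕ)
    (R : Fin B → Fin B → Fin B → O → O → O → Prop) [∀ i j l a b c, Decidable (R i j l a b c)] :
    ∃ ω : Fin B → O,
      #{t : Fin B × Fin B × Fin B | t.1 < t.2.1 ∧ t.2.1 < t.2.2 ∧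
          R t.1 t.2.1 t.2.2 (ω t.1) (ω t.2.1) (ω t.2.2)} * Fintype.card O ^ 3 ≤
        #{z : (Fin B × Fin B × Fin B) × (O × O × O) | z.1.1 < z.1.2.1 ∧ z.1.2.1 < z.1.2.2 ∧
          R z.1.1 z.1.2.1 z.1.2.2 z.2.1 z.2.2.1 z.2.2.2} := by
  set Z : Finset ((Fin B × Fin B × Fin B) × (O × O × O)) :=
    {z | z.1.1 < z.1.2.1 ∧ z.1.2.1 < z.1.2.2 ∧
          R z.1.1 z.1.2.1 z.1.2.2 z.2.1 z.2.2.1 z.2.2.2} with hZ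
  set M : (Fin B → O) → Finset (Fin B × Fin B × Fin B) := fun ω =>
    {t | t.1 < t.2.1 ∧ t.2.1 < t.2.2 ∧ R t.1 t.2.1 t.2.2 (ω t.1) (ω t.2.1) (ω t.2.2)} with hM
  -- Double counting of assignments against satisfied constraints: three distinct coordinates take
  -- prescribed values for a fraction `|O| ^ (-3)` of all assignments.
  have h1 : ∑ ω : Fin B → O, #(M ω) = ∑ z ∈ Z,
      #{ω : Fin B → O | ω z.1.1 = z.2.1 ∧ ω z.1.2.1 = z.2.2.1 ∧ ω z.1.2.2 = z.2.2.2} := by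
    have h2 : ∀ ω : Fin B → O, #(M ω) =
        #{z ∈ Z | ω z.1.1 = z.2.1 ∧ ω z.1.2.1 = z.2.2.1 ∧ ω z.1.2.2 = z.2.2.2} := by
      intro ω
      apply card_bij (fun t _ => (t, (ω t.1, ω t.2.1, ω t.2.2)))
      · intro t ht
        simp only [hM, mem_filter, mem_univ, true_and] at ht
        simp only [hZ, mem_filter, mem_univ, true_and, and_true]
        exact ht
      · intro t _ t' _ h
        exact (Prod.mk.inj h).1
      · rintro ⟨t, a, b, c⟩ hz
        simp only [hZ, mem_filter, mem_univ, true_and] at hz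
        obtain ⟨hz, rfl, rfl, rfl⟩ := hz
        exact ⟨t, by simpa only [hM, mem_filter, mem_univ, true_and] using hz, rfl⟩
    simp only [h2, card_filter]
    exact sum_comm
  have h3 : (∑ ω : Fin B → O, #(M ω)) * Fintype.card O ^ 3 = #Z * Fintype.card O ^ B := by
    rw [h1, sum_mul, ← smul_eq_mul (#Z), ← sum_const]
    apply sum_congr rfl
    intro z hz
    simp only [hZ, mem_filter, mem_univ, true_and] at hz
    have := card_filter_three_values_mul z.1.1 z.1.2.1 z.1.2.2 hz.1.ne
      (hz.1.trans hz.2.1).ne hz.2.1.ne z.2.1 z.2.2.1 z.2.2.2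
    rwa [Fintype.card_fin] at this
  by_contra hcon
  push Not at hcon
  have h4 : ∑ ω : Fin B → O, #Z < ∑ ω : Fin B → O, #(M ω) * Fintype.card O ^ 3 :=
    sum_lt_sum_of_nonempty univ_nonempty (fun ω _ => hcon ω)
  rw [← sum_mul, h3, sum_const, card_univ, Fintype.card_fun, Fintype.card_fin, smul_eq_mul,
    mul_comm] at h4
  exact lt_irrefl _ h4

/-! ### Lower bound: collinear triples near a parabola. -/

/-- The points of `S` all lie close to the parabola `K y = x ^ 2`, above the interval `[0, K)`. -/
def NearParabola (K s : ℕ) (S : Finset (ℤ × ℤ)) : Prop :=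
  ∀ p ∈ S, 0 ≤ p.1 ∧ p.1 < K ∧ |(K : ℤ) * p.2 - p.1 ^ 2| ≤ 5 * s * K

/-- The collinear triples in `S`, ordered from left to right. -/
def collinearTriples (S : Finset (ℤ × ℤ)) : Finset ((ℤ × ℤ) × (ℤ × ℤ) × (ℤ × ℤ)) :=
  (S ×ˢ S ×ˢ S).filter fun t => t.1.1 < t.2.1.1 ∧ t.2.1.1 < t.2.2.1 ∧
    (t.2.1.1 - t.1.1) * (t.2.2.2 - t.2.1.2) = (t.2.2.1 - t.2.1.1) * (t.2.1.2 - t.1.2)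

/-- The pairs in `S` whose difference is `m • (a, b)` for some `b`. -/
def pairsWithStep (S : Finset (ℤ × ℤ)) (a m : ℤ) : Finset ((ℤ × ℤ) × (ℤ × ℤ)) :=
  (S ×ˢ S).filter fun t => t.2.1 - t.1.1 = m * a ∧ m ∣ t.2.2 - t.1.2

/-- The triples in `S` of the form `p, p + u • (a, b), p + (u + w) • (a, b)` for some `b`. -/
def triplesWithStep (S : Finset (ℤ × ℤ)) (a u w : ℤ) :
    Finset ((ℤ × ℤ) × (ℤ × ℤ) × (ℤ × ℤ)) :=
  (S ×ˢ S ×ˢ S).filter fun t => t.2.1.1 - t.1.1 = u * a ∧ t.2.2.1 - t.2.1.1 = w * a ∧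
    (u ∣ t.2.1.2 - t.1.2) ∧ (w ∣ t.2.2.2 - t.2.1.2) ∧
      (t.2.1.2 - t.1.2) * w = (t.2.2.2 - t.2.1.2) * u

/-- Take the weighted second difference of `K y - x ^ 2` along the line: the linear part cancels and
`x ^ 2` contributes `u w (u + w) a ^ 2`, while each of the three values is at most `5 s K` in size.
-/
theorem NearParabola.mul_mul_sq_le {K s : ℕ} {S : Finset (ℤ × ℤ)} (hS : NearParabola K s S)
    {p q r : ℤ × ℤ} (hp : p ∈ S) (hq : q ∈ S) (hr : r ∈ S) {u w a b : ℤ} (hu : 0 < u)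
    (hw : 0 < w) (h1 : q.1 - p.1 = u * a) (h2 : r.1 - q.1 = w * a) (h3 : q.2 - p.2 = u * b)
    (h4 : r.2 - q.2 = w * b) : u * w * a ^ 2 ≤ 10 * s * K := by
  have e1 := abs_le.1 (hS p hp).2.2
  have e2 := abs_le.1 (hS q hq).2.2
  have e3 := abs_le.1 (hS r hr).2.2
  have i1 : p.1 = q.1 - u * a := by linarith
  have i2 : r.1 = q.1 + w * a := by linarith
  have i3 : p.2 = q.2 - u * b := by linarith
  have i4 : r.2 = q.2 + w * b := by linarith
  have key : w * ((K : ℤ) * p.2 - p.1 ^ 2) + u * ((K : ℤ) * r.2 - r.1 ^ 2)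
      - (u + w) * ((K : ℤ) * q.2 - q.1 ^ 2) = - (u * w * a ^ 2 * (u + w)) := by
    rw [i1, i2, i3, i4]
    ring
  have f1 : w * (-(5 * s * K)) ≤ w * ((K : ℤ) * p.2 - p.1 ^ 2) :=
    mul_le_mul_of_nonneg_left e1.1 hw.le
  have f2 : u * (-(5 * s * K)) ≤ u * ((K : ℤ) * r.2 - r.1 ^ 2) :=
    mul_le_mul_of_nonneg_left e3.1 hu.le
  have f3 : (u + w) * ((K : ℤ) * q.2 - q.1 ^ 2) ≤ (u + w) * (5 * s * K) :=
    mul_le_mul_of_nonneg_left e2.2 (by linarith)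
  have : u * w * a ^ 2 * (u + w) ≤ 10 * s * K * (u + w) := by linarith
  exact le_of_mul_le_mul_right this (by linarith)

/-- Here `z = (x, b)` records an abscissa and a vertical step `b`, which must be within `10 s / m`
of `(2 x a + m a ^ 2) / K`. If `m ≤ s`, count the steps `b` for each of the `K` abscissas. If `m >
s`, the steps span an interval of length `O(a)`, and each confines `x` to an interval of length `10
s K / (a m)`. -/
theorem card_near_slopes_le (K s a m : ℕ) (hs : 0 < s) (ha : 0 < a) (hm : 0 < m)
    (W : Finset (ℤ × ℤ))
    (hW : ∀ z ∈ W, 0 ≤ z.1 ∧ z.1 < K ∧ z.1 + m * a < K ∧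
      (m : ℤ) * |(K : ℤ) * z.2 - 2 * z.1 * a - m * a ^ 2| ≤ 10 * s * K) :
    (W.card : ℝ) ≤ 230 * (s * K / m + a) := by
  rcases W.eq_empty_or_nonempty with rfl | ⟨z₀, hz₀⟩
  · simp
    positivity
  have hK : 0 < K := by
    have := hW z₀ hz₀
    omega
  have hK' : (0 : ℝ) < K := by exact_mod_cast hK
  have hs' : (1 : ℝ) ≤ s := by exact_mod_cast hs
  have ha' : (1 : ℝ) ≤ a := by exact_mod_cast ha
  have hm' : (0 : ℝ) < m := by exact_mod_cast hm
  have hW' : ∀ z ∈ W, |(K : ℝ) * z.2 - 2 * z.1 * a - m * a ^ 2| ≤ 10 * (s : ℝ) * K / m := by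
    intro z hz
    rw [le_div_iff₀ hm', mul_comm]
    exact_mod_cast (hW z hz).2.2.2
  rcases le_or_gt m s with hms | hms
  · have hms' : (m : ℝ) ≤ s := by exact_mod_cast hms
    have h1 : W.card ≤ ⌊(20 * s / m + 1 : ℝ)⌋₊ * (W.image Prod.fst).card := by
      apply Finset.card_le_mul_card_image
      intro x _
      rw [Nat.le_floor_iff (by positivity)]
      have hinj : Set.InjOn Prod.snd ((W.filter (fun z => z.1 = x) : Finset (ℤ × ℤ)) :
          Set (ℤ × ℤ)) := by
        intro z hz z' hz' h
        rw [Finset.mem_coe, Finset.mem_filter] at hz hz'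
        exact Prod.ext (hz.2.trans hz'.2.symm) h
      rw [← Finset.card_image_of_injOn hinj]
      apply card_le_of_sub_le _ _ (by positivity)
      intro y hy y' hy'
      obtain ⟨z, hz, rfl⟩ := Finset.mem_image.1 hy
      obtain ⟨z', hz', rfl⟩ := Finset.mem_image.1 hy'
      rw [Finset.mem_filter] at hz hz'
      have e1 := (abs_le.1 (hW' z hz.1)).2
      have e2 := (abs_le.1 (hW' z' hz'.1)).1
      rw [hz.2] at e1
      rw [hz'.2] at e2
      have : (K : ℝ) * ((z.2 : ℝ) - z'.2) ≤ K * (20 * s / m) := by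
        have e : (K : ℝ) * (20 * s / m) = 2 * (10 * s * K / m) := by ring
        rw [e]
        linarith
      exact le_of_mul_le_mul_left this hK'
    have h2 : (W.image Prod.fst).card ≤ K := by
      have : W.image Prod.fst ⊆ Finset.Ico 0 (K : ℤ) := by
        intro x hx
        obtain ⟨z, hz, rfl⟩ := Finset.mem_image.1 hx
        exact Finset.mem_Ico.2 ⟨(hW z hz).1, (hW z hz).2.1⟩
      simpa using Finset.card_le_card this
    have h3 : (W.card : ℝ) ≤ (20 * s / m + 1) * K := by
      calc (W.card : ℝ) ≤ (⌊(20 * s / m + 1 : ℝ)⌋₊ : ℝ) * (W.image Prod.fst).card := by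
            exact_mod_cast h1
        _ ≤ (20 * s / m + 1) * K := by
            apply mul_le_mul (Nat.floor_le (by positivity)) (by exact_mod_cast h2)
            · positivity
            · positivity
    have h4 : 1 ≤ (s : ℝ) / m := by rwa [one_le_div hm']
    have h5 : (1 : ℝ) * K ≤ s / m * K := by gcongr
    have h6 : (s : ℝ) / m * K = s * K / m := by ring
    have h7 : (20 * (s : ℝ) / m + 1) * K = 20 * (s * K / m) + 1 * K := by ring
    have h8 : 0 ≤ (s : ℝ) * K / m := by positivity
    linarith
  · have hms' : (s : ℝ) ≤ m := by exact_mod_cast hms.le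
    have hR : (10 : ℝ) * s * K / m ≤ 10 * K := by
      rw [div_le_iff₀ hm']
      have : (s : ℝ) * K ≤ m * K := by gcongr
      linarith
    have h1 : W.card ≤ ⌊(10 * s * K / (a * m) + 1 : ℝ)⌋₊ * (W.image Prod.snd).card := by
      apply Finset.card_le_mul_card_image
      intro b _
      rw [Nat.le_floor_iff (by positivity)]
      have hinj : Set.InjOn Prod.fst ((W.filter (fun z => z.2 = b) : Finset (ℤ × ℤ)) :
          Set (ℤ × ℤ)) := by
        intro z hz z' hz' h
        rw [Finset.mem_coe, Finset.mem_filter] at hz hz'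
        exact Prod.ext h (hz.2.trans hz'.2.symm)
      rw [← Finset.card_image_of_injOn hinj]
      apply card_le_of_sub_le _ _ (by positivity)
      intro y hy y' hy'
      obtain ⟨z, hz, rfl⟩ := Finset.mem_image.1 hy
      obtain ⟨z', hz', rfl⟩ := Finset.mem_image.1 hy'
      rw [Finset.mem_filter] at hz hz'
      have e1 := (abs_le.1 (hW' z hz.1)).1
      have e2 := (abs_le.1 (hW' z' hz'.1)).2
      rw [hz.2] at e1
      rw [hz'.2] at e2
      have : (2 * a : ℝ) * ((z.1 : ℝ) - z'.1) ≤ 2 * a * (10 * s * K / (a * m)) := by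
        have e : (2 * a : ℝ) * (10 * s * K / (a * m)) = 2 * (10 * s * K / m) := by
          field_simp
        rw [e]
        linarith
      exact le_of_mul_le_mul_left this (by positivity)
    have h2 : ((W.image Prod.snd).card : ℝ) ≤ (2 * a + 20) + 1 := by
      apply card_le_of_sub_le _ _ (by positivity)
      intro y hy y' hy'
      obtain ⟨z, hz, rfl⟩ := Finset.mem_image.1 hy
      obtain ⟨z', hz', rfl⟩ := Finset.mem_image.1 hy'
      have e1 := (abs_le.1 (hW' z hz)).2
      have e2 := (abs_le.1 (hW' z' hz')).1
      obtain ⟨g1, g2, g3, -⟩ := hW z hz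
      obtain ⟨g1', g2', g3', -⟩ := hW z' hz'
      have k2 : (z.1 : ℝ) ≤ K := by exact_mod_cast g2.le
      have k3 : (z.1 : ℝ) + m * a ≤ K := by exact_mod_cast g3.le
      have k1 : (0 : ℝ) ≤ z'.1 := by exact_mod_cast g1'
      have m1 : ((z.1 : ℝ) + (z.1 + m * a)) * a ≤ (2 * K) * a := by
        gcongr
        linarith
      have m2 : (0 : ℝ) ≤ (z'.1 + (z'.1 + m * a)) * a := by positivity
      have : (K : ℝ) * ((z.2 : ℝ) - z'.2) ≤ K * (2 * a + 20) := by nlinarith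
      exact le_of_mul_le_mul_left this hK'
    have h3 : (W.card : ℝ) ≤ (10 * s * K / (a * m) + 1) * (23 * a) := by
      calc (W.card : ℝ) ≤ (⌊(10 * s * K / (a * m) + 1 : ℝ)⌋₊ : ℝ) * (W.image Prod.snd).card := by
            exact_mod_cast h1
        _ ≤ (10 * s * K / (a * m) + 1) * (23 * a) := by
            apply mul_le_mul (Nat.floor_le (by positivity)) (by linarith)
            · positivity
            · positivity
    have h4 : (10 * s * K / (a * m) + 1) * (23 * a) = 230 * ((s : ℝ) * K / m) + 23 * a := by
      field_simp
      ring
    linarith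

theorem NearParabola.card_pairsWithStep_le {K s : ℕ} {S : Finset (ℤ × ℤ)}
    (hS : NearParabola K s S) (hs : 0 < s) {a m : ℕ} (ha : 0 < a) (hm : 0 < m) :
    ((pairsWithStep S a m).card : ℝ) ≤ 11 * s * (230 * (s * K / m + a)) := by
  set N := pairsWithStep S a m with hN
  have hmem : ∀ t ∈ N, t.1 ∈ S ∧ t.2 ∈ S ∧ t.2.1 - t.1.1 = m * a ∧ (m : ℤ) ∣ t.2.2 - t.1.2 := by
    intro t ht
    rw [hN, pairsWithStep, Finset.mem_filter, Finset.mem_product] at ht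
    exact ⟨ht.1.1, ht.1.2, ht.2.1, ht.2.2⟩
  have hm0 : (m : ℤ) ≠ 0 := by exact_mod_cast hm.ne'
  have hm1 : (0 : ℤ) < m := by exact_mod_cast hm
  set f : (ℤ × ℤ) × (ℤ × ℤ) → ℤ × ℤ := fun t => (t.1.1, (t.2.2 - t.1.2) / m) with hf
  -- Once the abscissa and the step are known, only the height of the first point is free, and the
  -- strip around the parabola has vertical width `10 s`.
  have h1 : N.card ≤ 11 * s * (N.image f).card := by
    apply Finset.card_le_mul_card_image
    intro z _
    have hinj : Set.InjOn (fun t : (ℤ × ℤ) × (ℤ × ℤ) => t.1.2)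
        ((N.filter (fun t => f t = z) : Finset _) : Set ((ℤ × ℤ) × (ℤ × ℤ))) := by
      intro t ht t' ht' h
      rw [Finset.mem_coe, Finset.mem_filter] at ht ht'
      have e := ht.2.trans ht'.2.symm
      simp only [hf, Prod.mk.injEq] at e h
      obtain ⟨-, -, c1, d, c2⟩ := hmem t ht.1
      obtain ⟨-, -, c1', d', c2'⟩ := hmem t' ht'.1
      rw [c2, c2', Int.mul_ediv_cancel_left _ hm0, Int.mul_ediv_cancel_left _ hm0] at e
      rw [← e.2] at c2'
      exact Prod.ext (Prod.ext e.1 h) (Prod.ext (by linarith) (by linarith))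
    rw [← Finset.card_image_of_injOn hinj]
    have : (((N.filter (fun t => f t = z)).image (fun t => t.1.2)).card : ℝ) ≤ 10 * s + 1 := by
      apply card_le_of_sub_le _ _ (by positivity)
      intro y hy y' hy'
      obtain ⟨t, ht, rfl⟩ := Finset.mem_image.1 hy
      obtain ⟨t', ht', rfl⟩ := Finset.mem_image.1 hy'
      rw [Finset.mem_filter] at ht ht'
      have e := ht.2.trans ht'.2.symm
      simp only [hf, Prod.mk.injEq] at e
      obtain ⟨p1, p2, p3⟩ := hS _ (hmem t ht.1).1
      obtain ⟨p1', p2', p3'⟩ := hS _ (hmem t' ht'.1).1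
      rw [e.1] at p3
      have q := (abs_le.1 p3).2
      have q' := (abs_le.1 p3').1
      have : (K : ℤ) * (t.1.2 - t'.1.2) ≤ K * (10 * s) := by linarith
      have hK : (0 : ℤ) < K := by omega
      have := le_of_mul_le_mul_left this hK
      exact_mod_cast this
    have h2 : ((N.filter (fun t => f t = z)).image (fun t => t.1.2)).card ≤ 10 * s + 1 := by
      exact_mod_cast this
    omega
  have h2 : ((N.image f).card : ℝ) ≤ 230 * (s * K / m + a) := by
    apply card_near_slopes_le K s a m hs ha hm
    intro z hz
    obtain ⟨t, ht, rfl⟩ := Finset.mem_image.1 hz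
    obtain ⟨c0, c0', c1, d, c2⟩ := hmem t ht
    obtain ⟨p1, p2, p3⟩ := hS _ c0
    obtain ⟨p1', p2', p3'⟩ := hS _ c0'
    simp only [hf]
    rw [c2, Int.mul_ediv_cancel_left _ hm0]
    refine ⟨p1, p2, by linarith, ?_⟩
    rw [← abs_of_pos hm1, ← abs_mul, abs_of_pos hm1]
    have e : (m : ℤ) * ((K : ℤ) * d - 2 * t.1.1 * a - m * a ^ 2) =
        ((K : ℤ) * t.2.2 - t.2.1 ^ 2) - ((K : ℤ) * t.1.2 - t.1.1 ^ 2) := by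
      have e1 : t.2.1 = t.1.1 + m * a := by linarith
      have e2 : t.2.2 = t.1.2 + m * d := by linarith
      rw [e1, e2]
      ring
    rw [e]
    have q := abs_le.1 p3
    have q' := abs_le.1 p3'
    rw [abs_le]
    constructor <;> linarith
  calc (N.card : ℝ) ≤ 11 * s * ((N.image f).card : ℝ) := by exact_mod_cast h1
    _ ≤ _ := by gcongr

/-- Two points of the triple and the multipliers determine the third. This version and its mirror
image let the pair with the larger multiplier be kept, where the pair bound is stronger. -/
theorem card_triplesWithStep_le_right (S : Finset (ℤ × ℤ)) (a u w : ℤ) (hw : w ≠ 0) :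
    (triplesWithStep S a u w).card ≤ (pairsWithStep S a w).card := by
  apply Finset.card_le_card_of_injOn (fun t => t.2)
  · intro t ht
    simp only [triplesWithStep, pairsWithStep, Finset.mem_coe, Finset.mem_filter,
      Finset.mem_product] at ht ⊢
    tauto
  · intro t ht t' ht' h
    simp only [triplesWithStep, Finset.mem_coe, Finset.mem_filter] at ht ht' h
    refine Prod.ext (Prod.ext ?_ ?_) h
    · have h1 := ht.2.1
      have h2 := ht'.2.1
      rw [h] at h1
      linarith
    · have h1 := ht.2.2.2.2.2
      have h2 := ht'.2.2.2.2.2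
      rw [h, ← h2] at h1
      have := mul_right_cancel₀ hw h1
      linarith

theorem card_triplesWithStep_le_left (S : Finset (ℤ × ℤ)) (a u w : ℤ) (hu : u ≠ 0) :
    (triplesWithStep S a u w).card ≤ (pairsWithStep S a u).card := by
  apply Finset.card_le_card_of_injOn (fun t => (t.1, t.2.1))
  · intro t ht
    simp only [triplesWithStep, pairsWithStep, Finset.mem_coe, Finset.mem_filter,
      Finset.mem_product] at ht ⊢
    tauto
  · intro t ht t' ht' h
    simp only [triplesWithStep, Finset.mem_coe, Finset.mem_filter, Prod.mk.injEq] at ht ht' h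
    refine Prod.ext h.1 (Prod.ext h.2 (Prod.ext ?_ ?_))
    · have h1 := ht.2.2.1
      have h2 := ht'.2.2.1
      rw [h.2] at h1
      linarith
    · have h1 := ht.2.2.2.2.2
      have h2 := ht'.2.2.2.2.2
      rw [h.1, h.2, h2] at h1
      have := mul_right_cancel₀ hu h1
      linarith

/-- The index set of triples `(a, m, u)` with `u ≤ m` along which collinear triples are counted. -/
def stepIndices (K s : ℕ) : Finset (ℕ × ℕ × ℕ) :=
  (Finset.Icc 1 K ×ˢ Finset.Icc 1 K ×ˢ Finset.Icc 1 K).filter fun t =>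
    t.2.2 ≤ t.2.1 ∧ t.2.2 * t.2.1 * t.1 ^ 2 ≤ 10 * s * K ∧ t.1 * t.2.1 ≤ K

/-- Let `a` be the gcd of the two horizontal gaps `u a` and `w a`. Since `u` and `w` are coprime,
collinearity forces the vertical gaps to be `u b` and `w b` for one integer `b`. The two unions
correspond to which multiplier is larger. -/
theorem NearParabola.collinearTriples_subset {K s : ℕ} {S : Finset (ℤ × ℤ)}
    (hS : NearParabola K s S) : collinearTriples S ⊆
      ((stepIndices K s).biUnion fun t => triplesWithStep S t.1 t.2.2 t.2.1) ∪
      ((stepIndices K s).biUnion fun t => triplesWithStep S t.1 t.2.1 t.2.2) := by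
  rintro ⟨p, q, r⟩ ht
  simp only [collinearTriples, Finset.mem_filter, Finset.mem_product] at ht
  obtain ⟨⟨hp, hq, hr⟩, hpq, hqr, hcol⟩ := ht
  obtain ⟨d₁, hd₁⟩ := Int.eq_ofNat_of_zero_le (sub_nonneg.2 hpq.le)
  obtain ⟨d₂, hd₂⟩ := Int.eq_ofNat_of_zero_le (sub_nonneg.2 hqr.le)
  have hd₁pos : 0 < d₁ := by omega
  obtain ⟨a, u, w, ha, hcop, e1, e2⟩ := Nat.exists_coprime' (m := d₁) (n := d₂)
    (Nat.gcd_pos_of_pos_left _ hd₁pos)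
  have hd₂pos : 0 < d₂ := by omega
  have hu : 0 < u := Nat.pos_of_ne_zero (by rintro rfl; omega)
  have hw : 0 < w := Nat.pos_of_ne_zero (by rintro rfl; omega)
  have ha0 : (a : ℤ) ≠ 0 := by exact_mod_cast ha.ne'
  have f1 : q.1 - p.1 = (u : ℤ) * a := by rw [hd₁, e1]; push_cast; ring
  have f2 : r.1 - q.1 = (w : ℤ) * a := by rw [hd₂, e2]; push_cast; ring
  rw [f1, f2] at hcol
  have hcol' : (u : ℤ) * (r.2 - q.2) = w * (q.2 - p.2) := by
    apply mul_left_cancel₀ ha0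
    linarith
  have hcopZ : IsCoprime (u : ℤ) (w : ℤ) := Nat.isCoprime_iff_coprime.2 hcop
  obtain ⟨b, hb⟩ : (u : ℤ) ∣ q.2 - p.2 :=
    hcopZ.dvd_of_dvd_mul_left (Dvd.intro _ hcol')
  have hb' : r.2 - q.2 = w * b := by
    rw [hb] at hcol'
    have hu0 : (u : ℤ) ≠ 0 := by exact_mod_cast hu.ne'
    apply mul_left_cancel₀ hu0
    linarith
  have hX : u * w * a ^ 2 ≤ 10 * s * K := by
    have := hS.mul_mul_sq_le hp hq hr (by exact_mod_cast hu) (by exact_mod_cast hw) f1 f2 hb hb'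
    exact_mod_cast this
  have b1 : u * a < K := by
    have h1 := (hS p hp).1
    have h2 := (hS q hq).2.1
    have : (u : ℤ) * a < K := by linarith
    exact_mod_cast this
  have b2 : w * a < K := by
    have h1 := (hS q hq).1
    have h2 := (hS r hr).2.1
    have : (w : ℤ) * a < K := by linarith
    exact_mod_cast this
  have c1 : u ≤ u * a := Nat.le_mul_of_pos_right _ ha
  have c2 : w ≤ w * a := Nat.le_mul_of_pos_right _ ha
  have c3 : a ≤ w * a := Nat.le_mul_of_pos_left _ hw
  have hT : (p, q, r) ∈ triplesWithStep S a u w := by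
    simp only [triplesWithStep, Finset.mem_filter, Finset.mem_product]
    exact ⟨⟨hp, hq, hr⟩, f1, f2, ⟨b, hb⟩, ⟨b, hb'⟩, by rw [hb, hb']; ring⟩
  rw [Finset.mem_union, Finset.mem_biUnion, Finset.mem_biUnion]
  rcases le_total u w with huw | huw
  · left
    refine ⟨(a, w, u), ?_, hT⟩
    simp only [stepIndices, Finset.mem_filter, Finset.mem_product, Finset.mem_Icc]
    refine ⟨⟨⟨ha, by omega⟩, ⟨hw, by omega⟩, ⟨hu, by omega⟩⟩, huw, hX, by rw [mul_comm]; omega⟩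
  · right
    refine ⟨(a, u, w), ?_, hT⟩
    simp only [stepIndices, Finset.mem_filter, Finset.mem_product, Finset.mem_Icc]
    refine ⟨⟨⟨ha, by omega⟩, ⟨hu, by omega⟩, ⟨hw, by omega⟩⟩, huw, ?_, by rw [mul_comm]; omega⟩
    rwa [mul_comm w u]

theorem sum_inv_le_one_add_log (K : ℕ) :
    ∑ a ∈ Finset.Icc 1 K, (1 : ℝ) / a ≤ 1 + Real.log K := by
  have := harmonic_le_one_add_log K
  rw [harmonic_eq_sum_Icc] at this
  push_cast at this
  simpa [one_div] using this

/-- Each term is at most `min(1, Y² / m²) ≤ 4 Y² / (Y + m)²`, which is dominated by a telescoping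
difference. -/
theorem sum_le_four_mul (K : ℕ) (Y : ℝ) (hY : 0 < Y) (n : ℕ → ℝ) (hn : ∀ m, 0 < m → n m ≤ m)
    (hn' : ∀ m : ℕ, 0 < m → n m * m ≤ Y ^ 2) : ∑ m ∈ Finset.Icc 1 K, n m / m ≤ 4 * Y := by
  have hle : ∀ m ∈ Finset.Icc 1 K, n m / m ≤ 4 * Y ^ 2 * (1 / (Y + (m - 1 : ℕ)) - 1 / (Y + m)) := by
    intro m hm
    rw [Finset.mem_Icc] at hm
    have hm0 : 0 < m := by omega
    have hm1 : (1 : ℝ) ≤ m := by exact_mod_cast hm.1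
    rw [Nat.cast_sub hm.1, Nat.cast_one]
    have hpos : 0 < Y + ((m : ℝ) - 1) := by linarith
    have e : 4 * Y ^ 2 * (1 / (Y + ((m : ℝ) - 1)) - 1 / (Y + m)) =
        4 * Y ^ 2 / ((Y + ((m : ℝ) - 1)) * (Y + m)) := by
      field_simp
      ring
    rw [e, div_le_div_iff₀ (by linarith) (by positivity)]
    have h1 := hn m hm0
    have h2 := hn' m hm0
    have hprod : (Y + ((m : ℝ) - 1)) * (Y + m) ≤ (Y + m) ^ 2 := by nlinarith
    have hprod0 : 0 < (Y + ((m : ℝ) - 1)) * (Y + m) := by positivity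
    rcases le_total (m : ℝ) Y with h | h
    · calc n m * ((Y + ((m : ℝ) - 1)) * (Y + m)) ≤ m * ((Y + ((m : ℝ) - 1)) * (Y + m)) := by
            gcongr
        _ ≤ m * (4 * Y ^ 2) := by
            have : (Y + ((m : ℝ) - 1)) * (Y + m) ≤ 4 * Y ^ 2 := by nlinarith
            gcongr
        _ = _ := by ring
    · have : (Y + ((m : ℝ) - 1)) * (Y + m) ≤ 4 * m ^ 2 := by nlinarith
      rcases le_or_gt (n m) 0 with h0 | h0
      · calc n m * ((Y + ((m : ℝ) - 1)) * (Y + m)) ≤ 0 :=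
            mul_nonpos_of_nonpos_of_nonneg h0 hprod0.le
          _ ≤ _ := by positivity
      · calc n m * ((Y + ((m : ℝ) - 1)) * (Y + m)) ≤ n m * (4 * m ^ 2) := by gcongr
          _ = 4 * (n m * m) * m := by ring
          _ ≤ 4 * Y ^ 2 * m := by gcongr
  have htel : ∀ K : ℕ, ∑ m ∈ Finset.Icc 1 K, (1 / (Y + (m - 1 : ℕ)) - 1 / (Y + (m : ℝ))) =
      1 / Y - 1 / (Y + K) := by
    intro K
    induction K with
    | zero => simp
    | succ K ih =>
      rw [Finset.sum_Icc_succ_top (by omega), ih]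
      simp
  calc _ ≤ ∑ m ∈ Finset.Icc 1 K, 4 * Y ^ 2 * (1 / (Y + (m - 1 : ℕ)) - 1 / (Y + (m : ℝ))) :=
        Finset.sum_le_sum hle
    _ = 4 * Y ^ 2 * (1 / Y - 1 / (Y + K)) := by rw [← Finset.mul_sum, htel]
    _ ≤ 4 * Y ^ 2 * (1 / Y) := by
        gcongr
        have : 0 < 1 / (Y + K) := by positivity
        linarith
    _ = 4 * Y := by field_simp

theorem sum_stepIndices_le (K s : ℕ) (hK : 0 < K) (hs : 0 < s) :
    ∑ t ∈ stepIndices K s, ((s : ℝ) * K / t.2.1 + t.1) ≤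
      5 * s * K * Real.sqrt (10 * s * K) * (1 + Real.log K) := by
  set X : ℝ := 10 * s * K with hX
  have hXpos : 0 < X := by positivity
  -- `n a m` counts the admissible `u`. It satisfies `n ≤ m` and `n m a² ≤ X`, hence `n a ≤ √X`. For
  -- fixed `a`, these bound the two parts of the summand by multiples of `s K √X / a`, and the
  -- harmonic sum over `a` produces the logarithm.
  set n : ℕ → ℕ → ℝ := fun a m => (((Finset.Icc 1 K).filter fun u =>
    u ≤ m ∧ u * m * a ^ 2 ≤ 10 * s * K ∧ a * m ≤ K).card : ℝ) with hn
  have n1 : ∀ a m, n a m ≤ m := by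
    intro a m
    have : ((Finset.Icc 1 K).filter fun u =>
        u ≤ m ∧ u * m * a ^ 2 ≤ 10 * s * K ∧ a * m ≤ K) ⊆ Finset.Icc 1 m := by
      intro u hu
      simp only [Finset.mem_filter, Finset.mem_Icc] at hu ⊢
      omega
    have := Finset.card_le_card this
    rw [Nat.card_Icc, Nat.add_sub_cancel] at this
    simp only [hn]
    exact_mod_cast this
  have n2 : ∀ a m, 0 < a → 0 < m → n a m * m * a ^ 2 ≤ X := by
    intro a m ha hm
    have hma : 0 < m * a ^ 2 := by positivity
    have : ((Finset.Icc 1 K).filter fun u =>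
        u ≤ m ∧ u * m * a ^ 2 ≤ 10 * s * K ∧ a * m ≤ K) ⊆
          Finset.Icc 1 (10 * s * K / (m * a ^ 2)) := by
      intro u hu
      simp only [Finset.mem_filter, Finset.mem_Icc] at hu ⊢
      refine ⟨hu.1.1, ?_⟩
      rw [Nat.le_div_iff_mul_le hma, ← mul_assoc]
      exact hu.2.2.1
    have := Finset.card_le_card this
    rw [Nat.card_Icc, Nat.add_sub_cancel, Nat.le_div_iff_mul_le hma] at this
    simp only [hX, hn]
    rw [mul_assoc]
    exact_mod_cast this
  have n3 : ∀ a m, 0 < a → 0 < m → n a m * a ≤ Real.sqrt X := by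
    intro a m ha hm
    apply Real.le_sqrt_of_sq_le
    have h0 : 0 ≤ n a m := by simp only [hn]; positivity
    calc (n a m * a) ^ 2 = n a m * n a m * a ^ 2 := by ring
      _ ≤ n a m * m * a ^ 2 := by
          gcongr
          exact n1 a m
      _ ≤ X := n2 a m ha hm
  have n4 : ∀ a m, K < a * m → n a m = 0 := by
    intro a m h
    simp only [hn, Nat.cast_eq_zero, Finset.card_eq_zero, Finset.filter_eq_empty_iff]
    intro u _ hu
    omega
  have e : ∑ t ∈ stepIndices K s, ((s : ℝ) * K / t.2.1 + t.1) =
      ∑ a ∈ Finset.Icc 1 K, ∑ m ∈ Finset.Icc 1 K, n a m * ((s : ℝ) * K / m + a) := by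
    rw [stepIndices, Finset.sum_filter, Finset.sum_product]
    apply Finset.sum_congr rfl
    intro a _
    rw [Finset.sum_product]
    apply Finset.sum_congr rfl
    intro m _
    rw [← Finset.sum_filter]
    dsimp only
    rw [Finset.sum_const, nsmul_eq_mul]
  rw [e]
  have hrow : ∀ a ∈ Finset.Icc 1 K, ∑ m ∈ Finset.Icc 1 K, n a m * ((s : ℝ) * K / m + a) ≤
      5 * s * K * Real.sqrt X * (1 / a) := by
    intro a ha
    rw [Finset.mem_Icc] at ha
    have ha0 : 0 < a := by omega
    have ha' : (0 : ℝ) < a := by exact_mod_cast ha0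
    have g1 : ∑ m ∈ Finset.Icc 1 K, n a m / m ≤ 4 * (Real.sqrt X / a) := by
      apply sum_le_four_mul K _ (by positivity) _ (fun m _ => n1 a m)
      intro m hm
      rw [div_pow, Real.sq_sqrt hXpos.le, le_div_iff₀ (by positivity)]
      exact n2 a m ha0 hm
    have g2 : ∑ m ∈ Finset.Icc 1 K, n a m * a ≤ K / a * Real.sqrt X := by
      have hsub : Finset.Icc 1 (K / a) ⊆ Finset.Icc 1 K :=
        Finset.Icc_subset_Icc le_rfl (Nat.div_le_self _ _)
      rw [← Finset.sum_subset hsub]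
      · calc ∑ m ∈ Finset.Icc 1 (K / a), n a m * a
            ≤ ∑ m ∈ Finset.Icc 1 (K / a), Real.sqrt X := by
              apply Finset.sum_le_sum
              intro m hm
              rw [Finset.mem_Icc] at hm
              exact n3 a m ha0 (by omega)
          _ = ((K / a : ℕ) : ℝ) * Real.sqrt X := by simp
          _ ≤ _ := by
              gcongr
              exact Nat.cast_div_le
      · intro m _ hm'
        rw [n4, zero_mul]
        by_contra hc
        apply hm'
        rw [Finset.mem_Icc] at *
        refine ⟨by omega, ?_⟩
        rw [Nat.le_div_iff_mul_le ha0, mul_comm]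
        omega
    have e2 : ∑ m ∈ Finset.Icc 1 K, n a m * ((s : ℝ) * K / m + a) =
        s * K * ∑ m ∈ Finset.Icc 1 K, n a m / m + ∑ m ∈ Finset.Icc 1 K, n a m * a := by
      rw [Finset.mul_sum, ← Finset.sum_add_distrib]
      apply Finset.sum_congr rfl
      intro m _
      ring
    rw [e2]
    have g3 : (s : ℝ) * K * ∑ m ∈ Finset.Icc 1 K, n a m / m ≤
        s * K * (4 * (Real.sqrt X / a)) := by gcongr
    have g4 : (K : ℝ) / a * Real.sqrt X ≤ s * (K / a * Real.sqrt X) := by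
      apply le_mul_of_one_le_left (by positivity)
      exact_mod_cast hs
    have e3 : 5 * s * K * Real.sqrt X * (1 / a) =
        s * K * (4 * (Real.sqrt X / a)) + s * (K / a * Real.sqrt X) := by ring
    linarith
  calc _ ≤ ∑ a ∈ Finset.Icc 1 K, 5 * s * K * Real.sqrt X * ((1 : ℝ) / a) :=
        Finset.sum_le_sum hrow
    _ = 5 * s * K * Real.sqrt X * ∑ a ∈ Finset.Icc 1 K, ((1 : ℝ) / a) := by
        rw [Finset.mul_sum]
    _ ≤ _ := by
        gcongr
        exact sum_inv_le_one_add_log K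

theorem NearParabola.card_collinearTriples_le {K s : ℕ} {S : Finset (ℤ × ℤ)}
    (hS : NearParabola K s S) (hK : 0 < K) (hs : 0 < s) :
    ((collinearTriples S).card : ℝ) ≤
      101200 * s ^ 2 * K * Real.sqrt (s * K) * (1 + Real.log K) := by
  have h1 : (collinearTriples S).card ≤
      ∑ t ∈ stepIndices K s, 2 * (pairsWithStep S t.1 t.2.1).card := by
    refine (Finset.card_le_card hS.collinearTriples_subset).trans ?_
    refine (Finset.card_union_le _ _).trans ?_
    refine (add_le_add Finset.card_biUnion_le Finset.card_biUnion_le).trans ?_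
    rw [← Finset.sum_add_distrib]
    apply Finset.sum_le_sum
    intro t ht
    simp only [stepIndices, Finset.mem_filter, Finset.mem_product, Finset.mem_Icc] at ht
    have hm : (t.2.1 : ℤ) ≠ 0 := by omega
    have := card_triplesWithStep_le_right S t.1 t.2.2 t.2.1 hm
    have := card_triplesWithStep_le_left S t.1 t.2.1 t.2.2 hm
    omega
  have h2 : ((collinearTriples S).card : ℝ) ≤
      ∑ t ∈ stepIndices K s, 5060 * s * ((s : ℝ) * K / t.2.1 + t.1) := by
    calc ((collinearTriples S).card : ℝ)
        ≤ ∑ t ∈ stepIndices K s, 2 * ((pairsWithStep S t.1 t.2.1).card : ℝ) := by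
          exact_mod_cast h1
      _ ≤ _ := by
          apply Finset.sum_le_sum
          intro t ht
          simp only [stepIndices, Finset.mem_filter, Finset.mem_product, Finset.mem_Icc] at ht
          have := hS.card_pairsWithStep_le hs (a := t.1) (m := t.2.1) (by omega) (by omega)
          linarith
  rw [← Finset.mul_sum] at h2
  have h3 := sum_stepIndices_le K s hK hs
  have hsqrt : Real.sqrt (10 * s * K) ≤ 4 * Real.sqrt (s * K) := by
    rw [mul_assoc, Real.sqrt_mul (by norm_num)]
    gcongr
    rw [Real.sqrt_le_left (by norm_num)]
    norm_num
  have hlog : 0 ≤ 1 + Real.log K := by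
    have := Real.log_nonneg (x := K) (by exact_mod_cast hK)
    linarith
  calc ((collinearTriples S).card : ℝ)
      ≤ 5060 * s * (5 * s * K * Real.sqrt (10 * s * K) * (1 + Real.log K)) := by
        refine h2.trans ?_
        gcongr
    _ ≤ 5060 * s * (5 * s * K * (4 * Real.sqrt (s * K)) * (1 + Real.log K)) := by gcongr
    _ = _ := by ring

/-! ### Lower bound: the convex chain of boxes. -/

/-- The height (in units of the side length) of the `i`-th box of a convex chain of `B` boxes. -/
def boxHeight (B i : ℕ) : ℕ := i + i * i / B

/-- The linear term is there for strictness, because `i * i / B` alone repeats values; the shear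
removes it again when comparing with the parabola. -/
theorem boxHeight_lt {B i j : ℕ} (hij : i < j) : boxHeight B i < boxHeight B j := by
  have : i * i / B ≤ j * j / B := Nat.div_le_div_right (Nat.mul_le_mul hij.le hij.le)
  unfold boxHeight
  omega

/-- The point with offset `o` in the `i`-th box of a convex chain of `B` boxes of side `s`. -/
def boxPoint (B s i : ℕ) (o : Fin s × Fin s) : ℕ × ℕ :=
  (i * s + o.1, boxHeight B i * s + o.2)

/-- The shear `(x, y) ↦ (x, y - x)`, with integer values. -/
def shear (p : ℕ × ℕ) : ℤ × ℤ := (p.1, (p.2 : ℤ) - p.1)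

theorem mul_add_fin_lt {s a b : ℕ} (hab : a < b) (c d : Fin s) : a * s + c < b * s + d := by
  have h1 : (a + 1) * s ≤ b * s := Nat.mul_le_mul_right _ hab
  have := c.2
  rw [add_mul, one_mul] at h1
  omega

theorem boxPoint_fst_lt {B s i j : ℕ} (hij : i < j) (o o' : Fin s × Fin s) :
    (boxPoint B s i o).1 < (boxPoint B s j o').1 := mul_add_fin_lt hij _ _

theorem boxPoint_snd_lt {B s i j : ℕ} (hij : i < j) (o o' : Fin s × Fin s) :
    (boxPoint B s i o).2 < (boxPoint B s j o').2 := mul_add_fin_lt (boxHeight_lt hij) _ _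

theorem boxPoint_injective {B s i j : ℕ} {o o' : Fin s × Fin s}
    (h : boxPoint B s i o = boxPoint B s j o') : i = j ∧ o = o' := by
  have hij : i = j := by
    rcases lt_trichotomy i j with hij | hij | hij
    · exact absurd (congrArg Prod.fst h) (boxPoint_fst_lt hij o o').ne
    · exact hij
    · exact absurd (congrArg Prod.fst h) (boxPoint_fst_lt hij o' o).ne'
  subst hij
  simp only [boxPoint, Prod.mk.injEq, add_right_inj] at h
  exact ⟨rfl, Prod.ext (Fin.ext h.1) (Fin.ext h.2)⟩

theorem shear_injective : Function.Injective shear := by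
  rintro ⟨a, b⟩ ⟨c, d⟩ h
  simp only [shear, Prod.mk.injEq] at h
  exact Prod.ext (by simp only; omega) (by simp only; omega)

/-- All points of the convex chain of `B` boxes of side `s`, sheared. -/
def boxChain (B s : ℕ) : Finset (ℤ × ℤ) :=
  (Finset.univ : Finset (Fin B × (Fin s × Fin s))).image fun z => shear (boxPoint B s z.1 z.2)

theorem nearParabola_boxChain (B s : ℕ) : NearParabola (B * s) s (boxChain B s) := by
  intro p hp
  obtain ⟨⟨i, α, β⟩, -, rfl⟩ := Finset.mem_image.1 hp
  have hi := i.2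
  have hα := α.2
  have hβ := β.2
  have hB : 0 < B := by omega
  simp only [shear, boxPoint, boxHeight]
  generalize (i : ℕ) = i at *
  generalize (α : ℕ) = α at *
  generalize (β : ℕ) = β at *
  have hdiv := Nat.div_add_mod (i * i) B
  have hmod := Nat.mod_lt (i * i) hB
  generalize i * i / B = d at *
  generalize i * i % B = e at *
  refine ⟨by positivity, ?_, ?_⟩
  · have h1 : (i + 1) * s ≤ B * s := Nat.mul_le_mul_right _ hi
    rw [add_mul, one_mul] at h1
    have : i * s + α < B * s := by omega
    exact_mod_cast this
  · have hdiv' : (B : ℤ) * d + e = i * i := by exact_mod_cast hdiv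
    push_cast
    -- Rounding and offsets leave five negative contributions, counting `i s α` twice, each at most
    -- `B s²`; this is the factor 5 in `NearParabola`.
    have key : (B : ℤ) * s * ((i + d) * s + β - (i * s + α)) - (i * s + α) ^ 2 =
        B * s * β - (e * s * s + B * s * α + 2 * (i * s * α) + α * α) := by
      linear_combination (s : ℤ) * s * hdiv'
    rw [key]
    have b1 : B * s * β ≤ B * s * s := by gcongr
    have b2 : B * s * α ≤ B * s * s := by gcongr
    have b3 : e * s * s ≤ B * s * s := by gcongr
    have b4 : i * s * α ≤ B * s * s := by gcongr
    have b5 : α * α ≤ B * s * s := by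
      calc α * α ≤ 1 * s * s := by rw [one_mul]; gcongr
        _ ≤ _ := by gcongr; omega
    zify at b1 b2 b3 b4 b5
    have c1 : (0 : ℤ) ≤ (B : ℤ) * s * β := by positivity
    have c2 : (0 : ℤ) ≤ (B : ℤ) * s * α := by positivity
    have c3 : (0 : ℤ) ≤ (e : ℤ) * s * s := by positivity
    have c4 : (0 : ℤ) ≤ (i : ℤ) * s * α := by positivity
    have c5 : (0 : ℤ) ≤ (α : ℤ) * α := by positivity
    rw [abs_le]
    constructor <;> linarith

/-- Integer points `p, q, r` are collinear, in determinant form. -/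
def DetZero (p q r : ℤ × ℤ) : Prop :=
  (q.1 - p.1) * (r.2 - q.2) = (r.1 - q.1) * (q.2 - p.2)

instance (p q r : ℤ × ℤ) : Decidable (DetZero p q r) := inferInstanceAs (Decidable (_ = _))

open Finset in
/-- One can choose a point in each box so that few of the triples of chosen points are
collinear. -/
theorem exists_choice_few_collinear (B s : ℕ) (hs : 0 < s) :
    ∃ ω : Fin B → Fin s × Fin s,
      #{t : Fin B × Fin B × Fin B | t.1 < t.2.1 ∧ t.2.1 < t.2.2 ∧
        DetZero (shear (boxPoint B s t.1 (ω t.1))) (shear (boxPoint B s t.2.1 (ω t.2.1)))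
          (shear (boxPoint B s t.2.2 (ω t.2.2)))} * s ^ 6 ≤ #(collinearTriples (boxChain B s)) := by
  have : NeZero s := ⟨hs.ne'⟩
  obtain ⟨ω, hω⟩ := exists_assignment_card_le (O := Fin s × Fin s) B
    (fun i j l a b c => DetZero (shear (boxPoint B s i a)) (shear (boxPoint B s j b))
      (shear (boxPoint B s l c)))
  refine ⟨ω, ?_⟩
  have e : Fintype.card (Fin s × Fin s) ^ 3 = s ^ 6 := by
    rw [Fintype.card_prod, Fintype.card_fin]
    ring
  rw [e] at hω
  refine hω.trans ?_
  apply card_le_card_of_injOn (fun z => (shear (boxPoint B s z.1.1 z.2.1),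
    shear (boxPoint B s z.1.2.1 z.2.2.1), shear (boxPoint B s z.1.2.2 z.2.2.2)))
  · intro z hz
    simp only [coe_filter, Set.mem_ofPred_eq, mem_univ, true_and] at hz
    simp only [collinearTriples, coe_filter, Set.mem_ofPred_eq, mem_product]
    have hmem : ∀ (i : Fin B) o, shear (boxPoint B s i o) ∈ boxChain B s := fun i o =>
      mem_image.2 ⟨(i, o), mem_univ _, rfl⟩
    refine ⟨⟨hmem _ _, hmem _ _, hmem _ _⟩, ?_, ?_, hz.2.2⟩
    · exact Int.ofNat_lt.2 (boxPoint_fst_lt (B := B) hz.1 _ _)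
    · exact Int.ofNat_lt.2 (boxPoint_fst_lt (B := B) hz.2.1 _ _)
  · rintro ⟨⟨i, j, l⟩, a, b, c⟩ - ⟨⟨i', j', l'⟩, a', b', c'⟩ - h
    simp only [Prod.mk.injEq] at h
    obtain ⟨h1, h2, h3⟩ := h
    obtain ⟨e1, rfl⟩ := boxPoint_injective (shear_injective h1)
    obtain ⟨e2, rfl⟩ := boxPoint_injective (shear_injective h2)
    obtain ⟨e3, rfl⟩ := boxPoint_injective (shear_injective h3)
    rw [Fin.ext e1, Fin.ext e2, Fin.ext e3]

/-! ### Lower bound: deletion and choice of parameters. -/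

/-- The grid point corresponding to a pair of natural numbers, coordinates starting from `0`. -/
def gridPoint (p : ℕ × ℕ) : ℝ × ℝ := (((p.1 + 1 : ℕ) : ℝ), ((p.2 + 1 : ℕ) : ℝ))

theorem gridPoint_injective : Function.Injective gridPoint := by
  rintro ⟨a, b⟩ ⟨c, d⟩ h
  simpa [gridPoint] using h

theorem detZero_of_collinear {p q r : ℕ × ℕ} (hpq : p ≠ q)
    (h : Collinear ℝ ({gridPoint p, gridPoint q, gridPoint r} : Set (ℝ × ℝ))) :
    DetZero (shear p) (shear q) (shear r) := by
  rw [collinear_triple_iff _ _ _ (gridPoint_injective.ne hpq)] at h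
  simp only [gridPoint] at h
  have h' : (((q.1 + 1 : ℕ) : ℤ) - (p.1 + 1 : ℕ)) * ((r.2 + 1 : ℕ) - (p.2 + 1 : ℕ)) =
      ((r.1 + 1 : ℕ) - (p.1 + 1 : ℕ)) * ((q.2 + 1 : ℕ) - (p.2 + 1 : ℕ)) := by
    exact_mod_cast h
  push_cast at h'
  simp only [DetZero, shear]
  linarith

/-- The last hypothesis is what makes the triple count divided by `s ^ 6` at most `B / 2`. The chain
has width `B s` and height at most `2 B s`, so it fits in the grid. -/
theorem half_le_maxMonotoneGP_grid (B s k : ℕ) (hB : 0 < B) (hs : 0 < s) (hk : 2 * (B * s) ≤ k)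
    (hsK : 202400 ^ 2 * ((B * s : ℕ) : ℝ) * (1 + Real.log (B * s : ℕ)) ^ 2 ≤ (s : ℝ) ^ 5) :
    (B : ℝ) / 2 ≤ maxMonotoneGP (grid k) := by
  classical
  obtain ⟨ω, hω⟩ := exists_choice_few_collinear B s hs
  set bad : Finset (Fin B × Fin B × Fin B) := {t : Fin B × Fin B × Fin B | t.1 < t.2.1 ∧
    t.2.1 < t.2.2 ∧ DetZero (shear (boxPoint B s t.1 (ω t.1)))
      (shear (boxPoint B s t.2.1 (ω t.2.1))) (shear (boxPoint B s t.2.2 (ω t.2.2)))} with hbad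
  have hK : 0 < B * s := by positivity
  have hs' : (0 : ℝ) < s := by exact_mod_cast hs
  have hbadcard : (bad.card : ℝ) ≤ B / 2 := by
    have h1 := (nearParabola_boxChain B s).card_collinearTriples_le hK hs
    have h2 : (bad.card : ℝ) * s ^ 6 ≤ (collinearTriples (boxChain B s)).card := by
      exact_mod_cast hω
    have hlog : 0 ≤ 1 + Real.log (B * s : ℕ) := by
      have := Real.log_nonneg (x := (B * s : ℕ)) (by exact_mod_cast hK)
      linarith
    have h3 : 202400 * Real.sqrt (s * (B * s : ℕ)) * (1 + Real.log (B * s : ℕ)) ≤ (s : ℝ) ^ 3 := by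
      apply le_of_sq_le_sq _ (by positivity)
      rw [mul_pow, mul_pow, Real.sq_sqrt (by positivity)]
      calc _ = s * (202400 ^ 2 * ((B * s : ℕ) : ℝ) * (1 + Real.log (B * s : ℕ)) ^ 2) := by ring
        _ ≤ s * (s : ℝ) ^ 5 := by gcongr
        _ = _ := by ring
    have h4 : (101200 * s ^ 2 * (B * s : ℕ) * Real.sqrt (s * (B * s : ℕ)) *
        (1 + Real.log (B * s : ℕ)) : ℝ) ≤ B / 2 * s ^ 6 := by
      calc _ = (s ^ 2 * (B * s : ℕ) / 2 : ℝ) * (202400 * Real.sqrt (s * (B * s : ℕ)) *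
            (1 + Real.log (B * s : ℕ))) := by ring
        _ ≤ (s ^ 2 * (B * s : ℕ) / 2 : ℝ) * s ^ 3 := by gcongr
        _ = _ := by push_cast; ring
    have h5 : (bad.card : ℝ) * s ^ 6 ≤ B / 2 * s ^ 6 := h2.trans (h1.trans h4)
    exact le_of_mul_le_mul_right h5 (by positivity)
  -- Dropping the leftmost box of every bad triple destroys them all.
  set I : Finset (Fin B) := Finset.univ \ bad.image Prod.fst with hI
  have hIcard : (B : ℝ) / 2 ≤ I.card := by
    have h1 : B ≤ I.card + bad.card := by
      have h2 := Finset.le_card_sdiff (bad.image Prod.fst) (Finset.univ : Finset (Fin B))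
      rw [Finset.card_univ, Fintype.card_fin, ← hI] at h2
      have h3 : (bad.image Prod.fst).card ≤ bad.card := Finset.card_image_le
      omega
    have : (B : ℝ) ≤ I.card + bad.card := by exact_mod_cast h1
    linarith
  set g : Fin B → ℝ × ℝ := fun i => gridPoint (boxPoint B s i (ω i)) with hg
  have hne : ∀ i j : Fin B, i ≠ j → boxPoint B s i (ω i) ≠ boxPoint B s j (ω j) := by
    intro i j hij h
    exact hij (Fin.ext (boxPoint_injective h).1)
  have hginj : Function.Injective g := by
    intro i j h
    by_contra hij
    exact hne i j hij (gridPoint_injective h)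
  have hord : ∀ i ∈ I, ∀ j ∈ I, ∀ l ∈ I, i < j → j < l →
      ¬ Collinear ℝ ({g i, g j, g l} : Set (ℝ × ℝ)) := by
    intro i hi j _ l _ hij hjl h
    have hd := detZero_of_collinear (hne i j hij.ne) h
    rw [hI, Finset.mem_sdiff] at hi
    apply hi.2
    refine Finset.mem_image.2 ⟨(i, j, l), ?_, rfl⟩
    rw [hbad, Finset.mem_filter]
    exact ⟨Finset.mem_univ _, hij, hjl, hd⟩
  have hmem : (I.card) ∈ monotoneGPSizes (grid k) := by
    refine ⟨I.image g, ?_, ?_, ?_, Finset.card_image_of_injective _ hginj⟩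
    · intro p hp
      obtain ⟨i, -, rfl⟩ := Finset.mem_image.1 (Finset.mem_coe.1 hp)
      have hi := i.2
      refine ⟨_, ?_, _, ?_, rfl⟩
      · rw [Finset.mem_Icc]
        refine ⟨by omega, ?_⟩
        have h1 : (boxPoint B s i (ω i)).1 < B * s + 0 := mul_add_fin_lt hi (ω i).1 ⟨0, hs⟩
        omega
      · rw [Finset.mem_Icc]
        refine ⟨by omega, ?_⟩
        have h2 : (i : ℕ) * i / B ≤ i := by
          calc (i : ℕ) * i / B ≤ i * B / B := Nat.div_le_div_right (Nat.mul_le_mul_left _ hi.le)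
            _ = i := Nat.mul_div_cancel _ hB
        have h3 : boxHeight B i < 2 * B := by
          unfold boxHeight
          omega
        have h1 : (boxPoint B s i (ω i)).2 < 2 * B * s + 0 := mul_add_fin_lt h3 (ω i).2 ⟨0, hs⟩
        rw [mul_assoc] at h1
        omega
    · left
      intro u hu v hv huv
      obtain ⟨i, -, rfl⟩ := Finset.mem_image.1 (Finset.mem_coe.1 hu)
      obtain ⟨j, -, rfl⟩ := Finset.mem_image.1 (Finset.mem_coe.1 hv)
      simp only [hg, gridPoint, Nat.cast_lt, Nat.cast_le, add_lt_add_iff_right,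
        add_le_add_iff_right] at huv ⊢
      rcases lt_trichotomy (i : ℕ) j with h | h | h
      · exact (boxPoint_snd_lt h _ _).le
      · rw [Fin.ext h]
      · exact absurd huv (boxPoint_fst_lt h _ _).not_gt
    · intro u hu v hv w hw huv huw hvw
      obtain ⟨i, hi, rfl⟩ := Finset.mem_image.1 (Finset.mem_coe.1 hu)
      obtain ⟨j, hj, rfl⟩ := Finset.mem_image.1 (Finset.mem_coe.1 hv)
      obtain ⟨l, hl, rfl⟩ := Finset.mem_image.1 (Finset.mem_coe.1 hw)
      have hij : i ≠ j := fun h => huv (by rw [h])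
      have hil : i ≠ l := fun h => huw (by rw [h])
      have hjl : j ≠ l := fun h => hvw (by rw [h])
      rcases lt_or_gt_of_ne hij with h1 | h1 <;> rcases lt_or_gt_of_ne hil with h2 | h2 <;>
        rcases lt_or_gt_of_ne hjl with h3 | h3
      · exact hord i hi j hj l hl h1 h3
      · rw [Set.pair_comm]
        exact hord i hi l hl j hj h2 h3
      · exact absurd (h1.trans h3) h2.not_gt
      · rw [Set.pair_comm, Set.insert_comm]
        exact hord l hl i hi j hj h2 h1
      · rw [Set.insert_comm]
        exact hord j hj i hi l hl h1 h2
      · exact absurd (h2.trans h3) h1.not_gt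
      · rw [Set.insert_comm, Set.pair_comm]
        exact hord j hj l hl i hi h3 h2
      · rw [Set.insert_comm, Set.pair_comm, Set.insert_comm]
        exact hord l hl j hj i hi h3 h1
  have := (isGreatest_maxMonotoneGP (finite_grid k)).2 hmem
  refine hIcard.trans ?_
  exact_mod_cast this

theorem le_maxMonotoneGP_grid (k : ℕ) (hk : 10 ^ 8 ≤ k) :
    1 / 3200 * (((k ^ 2 : ℕ) : ℝ) / Real.log (k ^ 2 : ℕ)) ^ ((2 : ℝ) / 5) ≤
      maxMonotoneGP (grid k) := by
  have hk' : (10 : ℝ) ^ 8 ≤ k := by exact_mod_cast hk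
  have hk0 : (0 : ℝ) < k := by linarith
  set L := Real.log k with hL
  have hL1 : 1 ≤ L := by
    rw [hL, Real.le_log_iff_exp_le hk0]
    linarith [Real.exp_one_lt_d9]
  have hLk : L ≤ k := by
    have := Real.log_le_sub_one_of_pos hk0
    linarith
  -- `s` is the least integer with `s ^ 5 ≥ V`, and `V` bounds the quantity required by
  -- `half_le_maxMonotoneGP_grid`; the 4 comes from `1 + log (B s) ≤ 2 L`.
  set V : ℝ := 4 * 202400 ^ 2 * k * L ^ 2 with hV
  have hVpos : 1 ≤ V := by
    have h1 : (1 : ℝ) ≤ L ^ 2 := one_le_pow₀ hL1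
    have h2 : (1 : ℝ) * 1 ≤ k * L ^ 2 := mul_le_mul (by linarith) h1 (by norm_num) hk0.le
    rw [hV]
    nlinarith
  set y : ℝ := V ^ ((1 : ℝ) / 5) with hy
  have hy5 : y ^ 5 = V := by
    rw [hy, ← Real.rpow_natCast, ← Real.rpow_mul (by linarith)]
    norm_num
  have hy1 : 1 ≤ y := Real.one_le_rpow hVpos (by norm_num)
  set s : ℕ := ⌈y⌉₊ with hs
  have hys : y ≤ s := Nat.le_ceil _
  have hs0 : 0 < s := Nat.ceil_pos.2 (by linarith)
  have hs0' : (0 : ℝ) < s := by exact_mod_cast hs0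
  have hs2y : (s : ℝ) ≤ 2 * y := by
    have := Nat.ceil_lt_add_one (a := y) (by linarith)
    linarith
  -- This gives `2 s ≤ k / 2`, so the floor in `B` costs at most a factor 2. The threshold `10 ^ 8`
  -- is used here, through `4 * 202400 ^ 2 * 8 ^ 5 ≤ k ^ 2`.
  have hyk : 8 * y ≤ k := by
    apply le_of_pow_le_pow_left₀ (n := 5) (by norm_num) hk0.le
    rw [mul_pow, hy5, hV]
    have h1 : L ^ 2 ≤ (k : ℝ) ^ 2 := by gcongr
    have h2 : (4 * 202400 ^ 2 * 8 ^ 5 : ℝ) ≤ (k : ℝ) ^ 2 := by nlinarith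
    calc (8 : ℝ) ^ 5 * (4 * 202400 ^ 2 * (k : ℝ) * L ^ 2)
        ≤ 8 ^ 5 * (4 * 202400 ^ 2 * (k : ℝ) * (k : ℝ) ^ 2) := by gcongr
      _ = (4 * 202400 ^ 2 * 8 ^ 5) * (k : ℝ) ^ 3 := by ring
      _ ≤ (k : ℝ) ^ 2 * (k : ℝ) ^ 3 := by gcongr
      _ = _ := by ring
  set B : ℕ := k / (2 * s) with hB
  have hBlt : (k : ℝ) < B * (2 * s) + 2 * s := by
    have := Nat.lt_div_mul_add (a := k) (b := 2 * s) (by positivity)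
    exact_mod_cast this
  have hBlow : (k : ℝ) ≤ B * (4 * s) := by linarith
  have hB0 : 0 < B := by
    rcases Nat.eq_zero_or_pos B with h | h
    · rw [h] at hBlow
      simp at hBlow
      linarith
    · exact h
  have hBk : 2 * (B * s) ≤ k := by
    have := Nat.div_mul_le_self k (2 * s)
    rw [← hB] at this
    linarith
  have hKk : ((B * s : ℕ) : ℝ) ≤ k := by
    have : B * s ≤ k := by omega
    exact_mod_cast this
  have hK1 : (1 : ℝ) ≤ (B * s : ℕ) := by
    have : 1 ≤ B * s := Nat.mul_pos hB0 hs0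
    exact_mod_cast this
  have hmain := half_le_maxMonotoneGP_grid B s k hB0 hs0 hBk (by
    have h1 : Real.log (B * s : ℕ) ≤ L := Real.log_le_log (by linarith) hKk
    have h0 : 0 ≤ Real.log (B * s : ℕ) := Real.log_nonneg hK1
    calc 202400 ^ 2 * ((B * s : ℕ) : ℝ) * (1 + Real.log (B * s : ℕ)) ^ 2
        ≤ 202400 ^ 2 * k * (L + L) ^ 2 := by gcongr
      _ = y ^ 5 := by rw [hy5, hV]; ring
      _ ≤ (s : ℝ) ^ 5 := by gcongr)
  refine le_trans ?_ hmain
  push_cast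
  rw [Real.log_pow, ← hL]
  push_cast
  set z : ℝ := ((k : ℝ) ^ 2 / (2 * L)) ^ ((2 : ℝ) / 5) with hz
  have hbase : (0 : ℝ) ≤ (k : ℝ) ^ 2 / (2 * L) := by positivity
  have hz5 : z ^ 5 = ((k : ℝ) ^ 2 / (2 * L)) ^ 2 := by
    rw [hz, ← Real.rpow_natCast, ← Real.rpow_mul hbase, ← Real.rpow_natCast]
    norm_num
  -- The logarithms cancel: `(z y) ^ 5 = 202400 ^ 2 * k ^ 5`, and `202400 ^ 2 ≤ 200 ^ 5`.
  have hzy : z * y / 200 ≤ k := by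
    apply le_of_pow_le_pow_left₀ (n := 5) (by norm_num) hk0.le
    rw [div_pow, mul_pow, hz5, hy5, hV]
    have e : ((k : ℝ) ^ 2 / (2 * L)) ^ 2 * (4 * 202400 ^ 2 * k * L ^ 2) =
        202400 ^ 2 * (k : ℝ) ^ 5 := by
      field_simp
      ring
    rw [e, div_le_iff₀ (by norm_num)]
    have : (0 : ℝ) ≤ (k : ℝ) ^ 5 := by positivity
    linarith
  have h1 : z * y ≤ 200 * (B * (8 * y)) := by
    have : (B : ℝ) * (4 * s) ≤ B * (4 * (2 * y)) := by gcongr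
    linarith
  have h2 : z * y ≤ (1600 * B) * y := by linarith
  have := le_of_mul_le_mul_right h2 (by linarith)
  linarith

end PlanarPoints

theorem mainTheorem5 :
    (∃ c : ℝ, 0 < c ∧ ∃ N : ℕ, ∀ n k : ℕ, N ≤ n → n = k ^ 2 →
      c * ((n : ℝ) / Real.log (n : ℝ)) ^ ((2 : ℝ) / 5) ≤
        (PlanarPoints.maxMonotoneGP (PlanarPoints.grid k) : ℝ)) ∧
    (∀ ε : ℝ, 0 < ε → ∃ N : ℕ, ∀ n k : ℕ, N ≤ n → n = k ^ 2 →
      (PlanarPoints.maxMonotoneGP (PlanarPoints.grid k) : ℝ) ≤ ε * Real.sqrt (n : ℝ)) := by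
  constructor
  · refine ⟨1 / 3200, by norm_num, (10 ^ 8) ^ 2, ?_⟩
    rintro n k hn rfl
    exact PlanarPoints.le_maxMonotoneGP_grid k (le_of_pow_le_pow_left₀ two_ne_zero k.zero_le hn)
  · intro ε hε
    obtain ⟨N₀, hN₀⟩ := PlanarPoints.maxMonotoneGP_grid_le ε hε
    refine ⟨N₀ ^ 2, ?_⟩
    rintro n k hn rfl
    rw [Nat.cast_pow, Real.sqrt_sq (Nat.cast_nonneg k)]
    exact hN₀ k (le_of_pow_le_pow_left₀ two_ne_zero k.zero_le hn)
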